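/- Let $\mathcal X$ be a smooth compact closed (Riemannian) manifold of dimension $n\ge 2$ with a smooth positive volume density $dx$, and let $E^0,\dots,E^N$ be smooth vector bundles over $\mathcal X$ with smooth inner products $(\cdot,\cdot)_x$ in the fibres (real bundles; a complex bundle with a Hermitian metric is regarded as a real one with the real part of the metric). Put $E^k=0$ for $k<0$ and $k>N$. Let $$0\to C^\infty_{E^0}(\mathcal X)\xrightarrow{A^0}C^\infty_{E^1}(\mathcal X)\xrightarrow{A^1}\cdots\xrightarrow{A^{N-1}}C^\infty_{E^N}(\mathcal X)\to0$$ be an elliptic complex of linear first order differential operators with smooth coefficients, that is, $A^{k+1}A^k=0$ and all the Laplacians $\Delta^k=(A^k)^*A^k+A^{k-1}(A^{k-1})^*$ are strongly elliptic of second order. Here $(A^k)^*$ is the formal adjoint of $A^k$ with respect to $(u,v)_k=\int_{\mathcal X}(u,v)_x\,dx$, and $A^k=0$ for $k<0$ or $k>N-1$. Fix $0\le i\le N$, $T>0$, $\mu>0$, write $\mathcal X_T=\mathcal X\times[0,T]$, and let $\mathcal M_{1,x}:E^{i+1}_x\otimes E^i_x\to E^i_x$ and $\mathcal M_{2,x}:E^i_x\otimes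 E^i_x\to E^{i-1}_x$ be bilinear mappings, depending measurably on $x\in\mathcal X$, such that $|\mathcal M_{1,x}(v,u)|\le c_1|u||v|$ and $|\mathcal M_{2,x}(w,u)|\le c_2|u||w|$ with constants $c_1,c_2$ independent of $x$, $v$, $u$, $w$. Let $u^{(0)}$ be a continuous section over $\mathcal X_T$ of the bundle induced by $E^i$ such that $A^iu^{(0)}$ (in the sense of distributions in $\mathcal X$, for each $t$) is a continuous section over $\mathcal X_T$ too, and set $$V_0^iu=\mathcal M_1(A^iu^{(0)},u)+\mathcal M_1(A^iu,u^{(0)})+A^{i-1}\bigl(\mathcal M_2(u,u^{(0)})+\mathcal M_2(u^{(0)},u)\bigr).$$ Let $u$ be a section over $\mathcal X_T$ of the bundle induced by $E^i$ which is continuous together with its derivatives in $x$ up to order two and its first derivative in $t$, and let $p$ be a continuous section over $\mathcal X_T$ of the bundle induced by $E^{i-1}$ such that $A^{i-1}p$ is a continuous section over $\mathcal X_T$. Suppose that $$\partial_tu+\mu\Delta^iu+V_0^iu+A^{i-1}p=0\ \text{ in }\mathcal X\times(0,T),$$ $$(A^{i-1})^*u=0,\quad (A^{i-2})^*p=0\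 \text{ in }\mathcal X\times[0,T],\qquad u(\cdot,0)=0\ \text{ in }\mathcal X,$$ where the differential operators on $\mathcal X$ act in the sense of distributions for each fixed $t$. Then $u=0$ and $A^{i-1}p=0$ identically on $\mathcal X_T$. -/

import Mathlib

open Set MeasureTheory Bundle
open scoped Manifold ContDiff Topology InnerProductSpace

noncomputable section

namespace NSComplex

/-! ### Differential operators between smooth vector bundles -/

section Operators

variable {n : ℕ} {X : Type*} [TopologicalSpace X] [ChartedSpace (EuclideanSpace ℝ (Fin n)) X]

section OneBundle

variable (F : Type*) [NormedAddCommGroup F] [NormedSpace ℝ F]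
  (E : X → Type*) [∀ x, NormedAddCommGroup (E x)] [∀ x, InnerProductSpace ℝ (E x)]
  [TopologicalSpace (TotalSpace F E)] [FiberBundle F E] [VectorBundle ℝ F E]

/-- The space of smooth sections of the bundle `E` over `X`. -/
abbrev SmoothSection : Type _ := Cₛ^∞⟮𝓡 n; F, E⟯

variable {F E}

/-- The product of a smooth function and a smooth section. -/
def mulSection (f : C^∞⟮𝓡 n, X; ℝ⟯) (u : SmoothSection (n := n) F E) :
    SmoothSection (n := n) F E :=
  ⟨fun x => f x • u x, f.contMDiff.smul_section u.contMDiff⟩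

end OneBundle

variable {F₁ F₂ : Type*} [NormedAddCommGroup F₁] [NormedSpace ℝ F₁]
  [NormedAddCommGroup F₂] [NormedSpace ℝ F₂]
  {E₁ E₂ : X → Type*}
  [∀ x, NormedAddCommGroup (E₁ x)] [∀ x, InnerProductSpace ℝ (E₁ x)]
  [∀ x, NormedAddCommGroup (E₂ x)] [∀ x, InnerProductSpace ℝ (E₂ x)]
  [TopologicalSpace (TotalSpace F₁ E₁)] [FiberBundle F₁ E₁] [VectorBundle ℝ F₁ E₁]
  [TopologicalSpace (TotalSpace F₂ E₂)] [FiberBundle F₂ E₂] [VectorBundle ℝ F₂ E₂]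

/-- The commutator `[P, f] u = P (f u) - f P u` of an operator with the multiplication by `f`. -/
def comm (P : SmoothSection (n := n) F₁ E₁ → SmoothSection (n := n) F₂ E₂)
    (f : C^∞⟮𝓡 n, X; ℝ⟯) (u : SmoothSection (n := n) F₁ E₁) : SmoothSection (n := n) F₂ E₂ :=
  P (mulSection f u) - mulSection f (P u)

/-- A linear operator between smooth sections is a differential operator of order at most one
with smooth coefficients iff all its iterated commutators `[[P, f], g]` with smooth functions
vanish. -/
def IsFirstOrder (P : SmoothSection (n := n) F₁ E₁ →ₗ[ℝ] SmoothSection (n := n) F₂ E₂) : Prop :=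
  ∀ (f g : C^∞⟮𝓡 n, X; ℝ⟯) (u : SmoothSection (n := n) F₁ E₁), comm (comm P f) g u = 0

/-- Strong ellipticity of a second order operator `P`, with the sign convention of the positive
Laplacian. For a second order operator, `[[P, f], f] u (x) = 2 σ(x, df x) (u x)`, where
`σ(x, ξ) = ∑ a_{jk}(x) ξ_j ξ_k` if `P = ∑ a_{jk}(x) ∂_j ∂_k + (lower order terms)`; the condition
is that `σ(x, ξ)` is negative definite for all `x` and all covectors `ξ ≠ 0`. -/
def IsStronglyElliptic
    (P : SmoothSection (n := n) F₁ E₁ →ₗ[ℝ] SmoothSection (n := n) F₁ E₁) : Prop :=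
  ∀ (x : X) (f : C^∞⟮𝓡 n, X; ℝ⟯) (u : SmoothSection (n := n) F₁ E₁),
    mfderiv (𝓡 n) 𝓘(ℝ, ℝ) f x ≠ 0 → u x ≠ 0 → ⟪comm (comm P f) f u x, u x⟫_ℝ < 0

/-- `B` is the formal adjoint of `A` : `(A u, v) = (u, B v)` for all smooth sections `u`, `v`. -/
def IsFormalAdjoint [MeasurableSpace X] (ν : Measure X)
    (A : SmoothSection (n := n) F₁ E₁ →ₗ[ℝ] SmoothSection (n := n) F₂ E₂)
    (B : SmoothSection (n := n) F₂ E₂ →ₗ[ℝ] SmoothSection (n := n) F₁ E₁) : Prop :=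
  ∀ (u : SmoothSection (n := n) F₁ E₁) (v : SmoothSection (n := n) F₂ E₂),
    ∫ x, ⟪A u x, v x⟫_ℝ ∂ν = ∫ x, ⟪u x, B v x⟫_ℝ ∂ν

/-- `A u = g` in the sense of distributions on `X`, for (not necessarily smooth) sections `u`, `g`,
where `B` is the formal adjoint of the differential operator `A`. -/
def DistribEq [MeasurableSpace X] (ν : Measure X)
    (B : SmoothSection (n := n) F₂ E₂ →ₗ[ℝ] SmoothSection (n := n) F₁ E₁)
    (u : ∀ x, E₁ x) (g : ∀ x, E₂ x) : Prop :=
  ∀ φ : SmoothSection (n := n) F₂ E₂, ∫ x, ⟪u x, B φ x⟫_ℝ ∂ν = ∫ x, ⟪g x, φ x⟫_ℝ ∂ν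

open Classical in
/-- The section `A u`, for a section `u` such that the distribution `A u` is a continuous section
(e.g. for `u` of class `C^1` and `A` of first order); `B` is the formal adjoint of `A`.
The value is zero for all other `u`. -/
def distribApply [MeasurableSpace X] (ν : Measure X)
    (B : SmoothSection (n := n) F₂ E₂ →ₗ[ℝ] SmoothSection (n := n) F₁ E₁)
    (u : ∀ x, E₁ x) : ∀ x, E₂ x :=
  if h : ∃ g : ∀ x, E₂ x, Continuous (fun x => TotalSpace.mk' F₂ x (g x)) ∧ DistribEq ν B u g
  then h.choose else fun _ => 0

end Operators

/-- `ν` is a smooth positive volume density: in the charts of `X` it has a smooth positive density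
with respect to the Lebesgue measure. -/
def IsSmoothVolume {n : ℕ} {X : Type*} [TopologicalSpace X]
    [ChartedSpace (EuclideanSpace ℝ (Fin n)) X] [MeasurableSpace X] (ν : Measure X) : Prop :=
  ∀ x₀ : X, ∃ ρ : EuclideanSpace ℝ (Fin n) → ℝ,
    ContDiffOn ℝ ∞ ρ (chartAt (EuclideanSpace ℝ (Fin n)) x₀).target ∧
    (∀ y ∈ (chartAt (EuclideanSpace ℝ (Fin n)) x₀).target, 0 < ρ y) ∧
    Measure.map (chartAt (EuclideanSpace ℝ (Fin n)) x₀)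
        (ν.restrict (chartAt (EuclideanSpace ℝ (Fin n)) x₀).source) =
      (volume.restrict (chartAt (EuclideanSpace ℝ (Fin n)) x₀).target).withDensity
        (fun y => ENNReal.ofReal (ρ y))

/-! ### Time-dependent sections -/

section TimeDependent

variable {n : ℕ} {X : Type*} [TopologicalSpace X] [ChartedSpace (EuclideanSpace ℝ (Fin n)) X]
  (F : Type*) [NormedAddCommGroup F] [NormedSpace ℝ F]
  {E : X → Type*} [∀ x, NormedAddCommGroup (E x)] [∀ x, InnerProductSpace ℝ (E x)]
  [TopologicalSpace (TotalSpace F E)] [FiberBundle F E]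

/-- `u` is a continuous section over `X × [0, T]` of the bundle induced by `E`
(the class `C^{0,0,0,0}`). -/
def ContSection (T : ℝ) (u : ℝ → ∀ x, E x) : Prop :=
  ContinuousOn (fun q : ℝ × X => TotalSpace.mk' F q.2 (u q.1 q.2)) (Icc 0 T ×ˢ univ)

/-- The coordinate expression of a section in the preferred chart and trivialization at `x₀`. -/
def localRep (x₀ : X) (u : ∀ x, E x) (y : EuclideanSpace ℝ (Fin n)) : F :=
  (trivializationAt F E x₀ (TotalSpace.mk' F ((chartAt (EuclideanSpace ℝ (Fin n)) x₀).symm y)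
    (u ((chartAt (EuclideanSpace ℝ (Fin n)) x₀).symm y)))).2

variable (E) in
/-- The (open) domain of the coordinate expression of a section. -/
def localDom (x₀ : X) : Set (EuclideanSpace ℝ (Fin n)) :=
  (chartAt (EuclideanSpace ℝ (Fin n)) x₀).target ∩
    (chartAt (EuclideanSpace ℝ (Fin n)) x₀).symm ⁻¹' (trivializationAt F E x₀).baseSet

/-- The class `C^{2,0,1,0}` of sections over `X × [0, T]`: the section, its time derivative and its
derivatives in `x` up to order two exist and are continuous on `X × [0, T]` (their sup norms are
then finite, as `X` is compact). -/
structure IsC210 (T : ℝ) (u : ℝ → ∀ x, E x) : Prop where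
  cont : ContSection F T u
  time : ∃ v : ℝ → ∀ x, E x, ContSection F T v ∧
    ∀ t ∈ Icc 0 T, ∀ x, HasDerivWithinAt (fun s => u s x) (v t x) (Icc 0 T) t
  space_diff : ∀ x₀ : X, ∀ t ∈ Icc 0 T,
    ContDiffOn ℝ 2 (localRep (n := n) F x₀ (u t)) (localDom F E x₀)
  space_cont : ∀ x₀ : X, ∀ m ≤ 2,
    ContinuousOn (fun q : ℝ × EuclideanSpace ℝ (Fin n) =>
      iteratedFDeriv ℝ m (localRep F x₀ (u q.1)) q.2) (Icc 0 T ×ˢ localDom F E x₀)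

end TimeDependent

/-! ### Elliptic complexes and the linearised problem -/

section Complex

variable {n : ℕ} {X : Type*} [TopologicalSpace X] [ChartedSpace (EuclideanSpace ℝ (Fin n)) X]
  [MeasurableSpace X]
  (F : ℤ → Type*) [∀ k, NormedAddCommGroup (F k)] [∀ k, NormedSpace ℝ (F k)]
  (E : ℤ → X → Type*) [∀ k x, NormedAddCommGroup (E k x)]
  [∀ k x, InnerProductSpace ℝ (E k x)]
  [∀ k, TopologicalSpace (TotalSpace (F k) (E k))] [∀ k, FiberBundle (F k) (E k)]
  [∀ k, VectorBundle ℝ (F k) (E k)]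

/-- An elliptic complex `0 → Γ(E 0) → Γ(E 1) → ⋯ → Γ(E N) → 0` of first order differential
operators, with the bundles `E k` zero for `k < 0` and `k > N`. The operator `A^k` is
`d k (k + 1)` and its formal adjoint `(A^k)^*` is `dstar k (k + 1)`; the values of `d j k` and
`dstar j k` for `k ≠ j + 1` play no role. -/
structure EllipticComplex (N : ℕ) (ν : Measure X) where
  d : ∀ j k : ℤ, SmoothSection (n := n) (F j) (E j) →ₗ[ℝ] SmoothSection (n := n) (F k) (E k)
  dstar : ∀ j k : ℤ, SmoothSection (n := n) (F k) (E k) →ₗ[ℝ] SmoothSection (n := n) (F j) (E j)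
  zero_outside : ∀ k : ℤ, k < 0 ∨ (N : ℤ) < k → Subsingleton (F k)
  firstOrder : ∀ j k : ℤ, j + 1 = k → IsFirstOrder (d j k)
  isFormalAdjoint : ∀ j k : ℤ, j + 1 = k → IsFormalAdjoint ν (d j k) (dstar j k)
  d_comp_d : ∀ j k l : ℤ, j + 1 = k → k + 1 = l → (d k l) ∘ₗ (d j k) = 0
  /-- the Laplacians are strongly elliptic -/
  elliptic : ∀ j k l : ℤ, j + 1 = k → k + 1 = l →
    IsStronglyElliptic ((dstar k l) ∘ₗ (d k l) + (d j k) ∘ₗ (dstar j k))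

variable {F E}

/-- The Laplacian `Δ^i = (A^i)^* A^i + A^{i-1} (A^{i-1})^*`. -/
def EllipticComplex.laplacian {N : ℕ} {ν : Measure X} (C : EllipticComplex (n := n) F E N ν)
    (i : ℤ) : SmoothSection (n := n) (F i) (E i) →ₗ[ℝ] SmoothSection (n := n) (F i) (E i) :=
  (C.dstar i (i + 1)) ∘ₗ (C.d i (i + 1)) + (C.d (i - 1) i) ∘ₗ (C.dstar (i - 1) i)

/-- The section `A^i u` (for sections `u` for which it is continuous). -/
def EllipticComplex.apply {N : ℕ} {ν : Measure X} (C : EllipticComplex (n := n) F E N ν)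
    (i : ℤ) (u : ∀ x, E i x) : ∀ x, E (i + 1) x :=
  distribApply ν (C.dstar i (i + 1)) u

/-- The class `C^{0,0,0,0} ∩ 𝒟_A`, for the operator `A` with the formal adjoint `B`: continuous
sections `u` over `X × [0, T]` such that `A u` is a continuous section over `X × [0, T]`. -/
def InDomain {j k : ℤ} (ν : Measure X) (T : ℝ)
    (B : SmoothSection (n := n) (F k) (E k) →ₗ[ℝ] SmoothSection (n := n) (F j) (E j))
    (u : ℝ → ∀ x, E j x) : Prop :=
  ContSection (F j) T u ∧ ∃ g : ℝ → ∀ x, E k x, ContSection (F k) T g ∧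
    ∀ t ∈ Icc 0 T, DistribEq ν B (u t) (g t)

variable (F) in
/-- The bilinear mappings `M_{i,1,x} : E^{i+1}_x ⊗ E^i_x → E^i_x`,
`M_{i,2,x} : E^i_x ⊗ E^i_x → E^{i-1}_x`, with `|M_{i,1,x}(v, u)| ≤ c₁ |u| |v|`,
`|M_{i,2,x}(w, u)| ≤ c₂ |u| |w|`; their dependence on the point `x` is only required to be
measurable. -/
structure BilinearMaps (E : ℤ → X → Type*) [∀ k x, NormedAddCommGroup (E k x)]
    [∀ k x, InnerProductSpace ℝ (E k x)] [∀ k, TopologicalSpace (TotalSpace (F k) (E k))]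
    (i : ℤ) (ν : Measure X) where
  M₁ : ∀ x, E (i + 1) x →ₗ[ℝ] E i x →ₗ[ℝ] E i x
  M₂ : ∀ x, E i x →ₗ[ℝ] E i x →ₗ[ℝ] E (i - 1) x
  bound₁ : ∃ c₁ : ℝ, ∀ x v u, ‖M₁ x v u‖ ≤ c₁ * ‖u‖ * ‖v‖
  bound₂ : ∃ c₂ : ℝ, ∀ x w u, ‖M₂ x w u‖ ≤ c₂ * ‖u‖ * ‖w‖
  measurable₁ : ∀ (v : ∀ x, E (i + 1) x) (u w : ∀ x, E i x),
    Continuous (fun x => TotalSpace.mk' (F (i + 1)) x (v x)) →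
    Continuous (fun x => TotalSpace.mk' (F i) x (u x)) →
    Continuous (fun x => TotalSpace.mk' (F i) x (w x)) →
    AEMeasurable (fun x => ⟪M₁ x (v x) (u x), w x⟫_ℝ) ν
  measurable₂ : ∀ (v u : ∀ x, E i x) (w : ∀ x, E (i - 1) x),
    Continuous (fun x => TotalSpace.mk' (F i) x (v x)) →
    Continuous (fun x => TotalSpace.mk' (F i) x (u x)) →
    Continuous (fun x => TotalSpace.mk' (F (i - 1)) x (w x)) →
    AEMeasurable (fun x => ⟪M₂ x (v x) (u x), w x⟫_ℝ) ν

/-- `(u, p)` satisfies the linearised problem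
`∂_t u + μ Δ^i u + V u + A^{i-1} p = f` in `X × (0, T)`,
`(A^{i-1})^* u = 0`, `(A^{i-2})^* p = 0` in `X × [0, T]`, `u(·, 0) = u_init` in `X`, where
`V u = M₁(A^i u⁰, u) + M₁(A^i u, u⁰) + A^{i-1} (M₂(u, u⁰) + M₂(u⁰, u))`.
The differential operators are understood in the sense of distributions on `X`,
for each fixed time. -/
structure IsLinearisedSolution {N : ℕ} {ν : Measure X} (C : EllipticComplex (n := n) F E N ν)
    (i : ℤ) (M : BilinearMaps F E i ν) (T μ : ℝ) (u₀ : ℝ → ∀ x, E i x)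
    (f : ℝ → ∀ x, E i x) (uinit : ∀ x, E i x)
    (u : ℝ → ∀ x, E i x) (p : ℝ → ∀ x, E (i - 1) x) : Prop where
  momentum : ∀ t ∈ Ioo 0 T, ∀ φ : SmoothSection (n := n) (F i) (E i),
    (∫ x, ⟪deriv (fun s => u s x) t, φ x⟫_ℝ ∂ν)
      + μ * (∫ x, ⟪u t x, C.laplacian i φ x⟫_ℝ ∂ν)
      + (∫ x, ⟪M.M₁ x (C.apply i (u₀ t) x) (u t x) + M.M₁ x (C.apply i (u t) x) (u₀ t x),
          φ x⟫_ℝ ∂ν)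
      + (∫ x, ⟪M.M₂ x (u t x) (u₀ t x) + M.M₂ x (u₀ t x) (u t x), C.dstar (i - 1) i φ x⟫_ℝ ∂ν)
      + (∫ x, ⟪p t x, C.dstar (i - 1) i φ x⟫_ℝ ∂ν)
      = ∫ x, ⟪f t x, φ x⟫_ℝ ∂ν
  divergence_u : ∀ t ∈ Icc 0 T, DistribEq ν (C.d (i - 1) i) (u t) (fun _ => 0)
  divergence_p : ∀ t ∈ Icc 0 T, DistribEq ν (C.d (i - 2) (i - 1)) (p t) (fun _ => 0)
  initial : ∀ x, u 0 x = uinit x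

end Complex

end NSComplex

end

/-!
The proof is the energy estimate. If the momentum equation is tested with `u(t)` itself, then the
pressure and the `A^{i-1} M₂` terms disappear because `(A^{i-1})^* u = 0`, the Laplacian gives
`μ ‖A^i u‖²`, and the `M₁` terms are bounded by `c (‖u‖² + ‖A^i u‖ ‖u‖)`. By Young's inequality,
`d/dt ‖u‖² ≤ 2 K ‖u‖²` with `K` independent of `t`, and Gronwall's inequality gives `u = 0`. The
equation with `u = 0` says that `A^{i-1} p = 0` at interior times, and both ends follow by
continuity.

The equation is given for smooth test sections only, and the operators are given only on smooth
sections, so the point is to approximate the `C^1` section `u(t)` by smooth sections `φ` such that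
`A^i φ` and `(A^{i-1})^* φ` converge uniformly (`exists_isLimOfSmooth`). The limits are then
the continuous sections `A^i u` and `0`, because continuous sections are determined by their
distributions (`eq_of_integral_inner_eq`); in particular `distribApply` takes the right value.

For the approximation, `u` is written as a finite sum of products `f e`, with smooth sections `e`
and `C^1` functions `f` supported in a chart, and `f` is mollified. Convergence of `P (f e)` needs
that a first order operator `P`, which is defined by the vanishing of its iterated commutators,
has a coordinate expression. This holds because `f ↦ [P, f] e` is a derivation
(`IsFirstOrder.comm_mul`), hence involves only the first derivatives of `f` by Hadamard's lemma
(`apply_mulSection_chartPull`). The formal adjoint is of first order as well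
(`IsFormalAdjoint.isFirstOrder`).
-/

namespace NSComplex

/-! ### Hadamard's lemma and mollification -/

section Euclidean

variable {V : Type*} [NormedAddCommGroup V] [NormedSpace ℝ V]

/-- Hadamard's lemma with a smooth remainder: `G y = ∫₀¹ h' (x₀ + t (y - x₀)) dt`. -/
theorem exists_contDiff_hadamard {h : V → ℝ} (hh : ContDiff ℝ ∞ h) (x₀ : V) :
    ∃ G : V → (V →L[ℝ] ℝ), ContDiff ℝ ∞ G ∧ (∀ y, h y - h x₀ = G y (y - x₀)) ∧
      G x₀ = fderiv ℝ h x₀ := by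
  have hd : ContDiff ℝ ∞ (fderiv ℝ h) := hh.fderiv_right (by simp)
  let κ : ContDiffBump (0 : ℝ) := ⟨1, 2, by norm_num, by norm_num⟩
  -- The smoothness in `y` is that of a convolution on `ℝ` depending on the parameter `y`,
  -- evaluated at `0`; the bump `κ` makes the integrand compactly supported.
  let g : V → ℝ → (V →L[ℝ] ℝ) := fun y s => κ s • fderiv ℝ h (x₀ - s • (y - x₀))
  let f : ℝ → ℝ := indicator (Ioc 0 1) 1
  have hf : LocallyIntegrable f volume :=
    (integrable_indicator_iff measurableSet_Ioc).2
      (integrableOn_const (by simp)) |>.locallyIntegrable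
  have hg : ContDiff ℝ ∞ (↿g) := by
    have h1 : ContDiff ℝ ∞ (fun q : V × ℝ => κ q.2) := κ.contDiff.comp contDiff_snd
    have h2 : ContDiff ℝ ∞ (fun q : V × ℝ => x₀ - q.2 • (q.1 - x₀)) := by fun_prop
    exact h1.smul (hd.comp h2)
  have key : ContDiffOn ℝ ∞ (fun y : V => convolution f (g y) (ContinuousLinearMap.lsmul ℝ ℝ)
      volume (0 : ℝ)) univ :=
    contDiffOn_convolution_right_with_param_comp (n := ⊤)
      (ContinuousLinearMap.lsmul ℝ ℝ) (v := fun _ => (0 : ℝ)) contDiffOn_const isOpen_univ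
      (isCompact_closedBall (0 : ℝ) 2) (fun y s _ hs => by
        have : κ s = 0 := κ.zero_of_le_dist (by
          simp only [Metric.mem_closedBall, not_le] at hs
          exact hs.le)
        simp [g, this]) hf hg.contDiffOn
  have hG : ∀ y, convolution f (g y) (ContinuousLinearMap.lsmul ℝ ℝ) volume (0 : ℝ)
      = ∫ t in (0 : ℝ)..1, fderiv ℝ h (x₀ + t • (y - x₀)) := by
    intro y
    rw [intervalIntegral.integral_of_le zero_le_one, convolution_def,
      ← integral_indicator measurableSet_Ioc]
    congr 1
    ext1 t
    by_cases ht : t ∈ Ioc (0 : ℝ) 1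
    · have hκ : κ (-t) = 1 := κ.one_of_mem_closedBall (by
        simp only [Metric.mem_closedBall, dist_zero_right, norm_neg, Real.norm_eq_abs]
        rw [abs_of_pos ht.1]; exact ht.2)
      simp [f, g, ht, hκ]
    · simp [f, ht]
  refine ⟨_, contDiffOn_univ.1 key, fun y => ?_, ?_⟩
  · rw [hG]
    have hcont : Continuous (fun t : ℝ => fderiv ℝ h (x₀ + t • (y - x₀))) :=
      hd.continuous.comp (by fun_prop)
    rw [ContinuousLinearMap.intervalIntegral_apply (hcont.intervalIntegrable _ _)]
    have hder : ∀ t ∈ uIcc (0 : ℝ) 1, HasDerivAt (fun t : ℝ => h (x₀ + t • (y - x₀)))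
        (fderiv ℝ h (x₀ + t • (y - x₀)) (y - x₀)) t := by
      intro t _
      have h1 : HasDerivAt (fun t : ℝ => x₀ + t • (y - x₀)) (y - x₀) t := by
        simpa using ((hasDerivAt_id t).smul_const (y - x₀)).const_add x₀
      exact ((hh.differentiable (by simp)) _).hasFDerivAt.comp_hasDerivAt t h1
    rw [intervalIntegral.integral_eq_sub_of_hasDerivAt hder
      ((hcont.clm_apply continuous_const).intervalIntegrable _ _)]
    simp
  · rw [hG]
    simp

/-- A compactly supported `C^1` function can be mollified: approximated in `C^1` norm by smooth
functions with support in a prescribed neighbourhood of its support. -/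
theorem exists_contDiff_C1_approx [FiniteDimensional ℝ V] {f : V → ℝ} (hf : ContDiff ℝ 1 f)
    (hc : HasCompactSupport f) {U : Set V} (hU : IsOpen U) (hfU : tsupport f ⊆ U)
    {ε : ℝ} (hε : 0 < ε) :
    ∃ h : V → ℝ, ContDiff ℝ ∞ h ∧ tsupport h ⊆ U ∧ (∀ x, |h x - f x| ≤ ε) ∧
      ∀ x, ‖fderiv ℝ h x - fderiv ℝ f x‖ ≤ ε := by
  let : MeasurableSpace V := borel V
  have : BorelSpace V := ⟨rfl⟩
  let ν : Measure V := Measure.addHaar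
  have hfd : Continuous (fderiv ℝ f) := hf.continuous_fderiv one_ne_zero
  have hu1 := hc.uniformContinuous_of_continuous hf.continuous
  have hu2 := (hc.fderiv ℝ).uniformContinuous_of_continuous hfd
  obtain ⟨δ₁, hδ₁, h₁⟩ := Metric.uniformContinuous_iff.1 hu1 ε hε
  obtain ⟨δ₂, hδ₂, h₂⟩ := Metric.uniformContinuous_iff.1 hu2 ε hε
  obtain ⟨δ₃, hδ₃, h₃⟩ := hc.isCompact.exists_cthickening_subset_open hU hfU
  obtain ⟨δ, hδ, hδm⟩ : ∃ δ > 0, δ ≤ δ₁ ∧ δ ≤ δ₂ ∧ δ ≤ δ₃ :=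
    ⟨min δ₁ (min δ₂ δ₃), by positivity, by simp, by simp, by simp⟩
  let φ : ContDiffBump (0 : V) := ⟨δ / 2, δ, by positivity, by linarith⟩
  have hφ : LocallyIntegrable (φ.normed ν) ν := φ.continuous_normed.locallyIntegrable
  refine ⟨convolution (φ.normed ν) f (ContinuousLinearMap.lsmul ℝ ℝ) ν, ?_, ?_, ?_, ?_⟩
  · exact φ.hasCompactSupport_normed.contDiff_convolution_left (n := ⊤) _ φ.contDiff_normed
      hf.continuous.locallyIntegrable
  · refine subset_trans ?_ h₃
    refine closure_minimal ?_ Metric.isClosed_cthickening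
    refine (support_convolution_subset _).trans ?_
    rw [φ.support_normed_eq]
    rintro _ ⟨a, ha, b, hb, rfl⟩
    refine Metric.mem_cthickening_of_dist_le _ b _ _ (subset_tsupport _ hb) ?_
    have : ‖a‖ < δ := by simpa [φ] using ha
    simp only [dist_eq_norm, add_sub_cancel_right]
    linarith [hδm.2.2]
  · intro x
    exact φ.dist_normed_convolution_le hf.continuous.aestronglyMeasurable
      fun y hy => (h₁ (lt_of_lt_of_le hy hδm.1)).le
  · intro x
    have := (hc.hasFDerivAt_convolution_right (ContinuousLinearMap.lsmul ℝ ℝ) hφ hf x).fderiv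
    rw [this, ← dist_eq_norm]
    have h4 := φ.dist_normed_convolution_le (μ := ν) (x₀ := x) (g := fderiv ℝ f)
      hfd.aestronglyMeasurable fun y hy => (h₂ (lt_of_lt_of_le hy hδm.2.1)).le
    convert h4 using 2
    simp only [convolution_def]
    congr 1

end Euclidean

/-! ### First order operators in a chart -/

section FirstOrder

variable {n : ℕ} {X : Type*} [TopologicalSpace X] [ChartedSpace (EuclideanSpace ℝ (Fin n)) X]
  {F₁ F₂ : Type*} [NormedAddCommGroup F₁] [NormedSpace ℝ F₁]
  [NormedAddCommGroup F₂] [NormedSpace ℝ F₂]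
  {E₁ E₂ : X → Type*}
  [∀ x, NormedAddCommGroup (E₁ x)] [∀ x, InnerProductSpace ℝ (E₁ x)]
  [∀ x, NormedAddCommGroup (E₂ x)] [∀ x, InnerProductSpace ℝ (E₂ x)]
  [TopologicalSpace (TotalSpace F₁ E₁)] [FiberBundle F₁ E₁] [VectorBundle ℝ F₁ E₁]
  [TopologicalSpace (TotalSpace F₂ E₂)] [FiberBundle F₂ E₂] [VectorBundle ℝ F₂ E₂]

@[simp]
theorem mulSection_apply (f : C^∞⟮𝓡 n, X; ℝ⟯) (u : SmoothSection (n := n) F₁ E₁) (x : X) :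
    mulSection f u x = f x • u x := rfl

theorem comm_apply (P : SmoothSection (n := n) F₁ E₁ → SmoothSection (n := n) F₂ E₂)
    (f : C^∞⟮𝓡 n, X; ℝ⟯) (u : SmoothSection (n := n) F₁ E₁) (x : X) :
    comm P f u x = P (mulSection f u) x - f x • P u x := rfl

variable (P : SmoothSection (n := n) F₁ E₁ →ₗ[ℝ] SmoothSection (n := n) F₂ E₂)
  (f g : C^∞⟮𝓡 n, X; ℝ⟯) (u : SmoothSection (n := n) F₁ E₁)

theorem comm_add : comm P (f + g) u = comm P f u + comm P g u := by
  have h : mulSection (f + g) u = mulSection f u + mulSection g u := by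
    ext x; simp [add_smul]
  ext x
  simp only [ContMDiffSection.coe_add, Pi.add_apply, comm_apply, h, map_add,
    ContMDiffMap.coe_add, add_smul]
  abel

theorem comm_smul (c : ℝ) : comm P (c • f) u = c • comm P f u := by
  have h : mulSection (c • f) u = c • mulSection f u := by
    ext x; simp [mul_smul]
  ext x
  simp [comm_apply, h, smul_sub, mul_smul]

theorem comm_sum {ι : Type*} (s : Finset ι) (f : ι → C^∞⟮𝓡 n, X; ℝ⟯) :
    comm P (∑ j ∈ s, f j) u = ∑ j ∈ s, comm P (f j) u := by
  classical
  induction s using Finset.induction_on with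
  | empty =>
    have h := comm_smul P 0 u 0
    rw [zero_smul] at h
    rw [Finset.sum_empty, Finset.sum_empty]
    exact h.trans (by ext x; simp)
  | insert a s ha ih => rw [Finset.sum_insert ha, Finset.sum_insert ha, comm_add, ih]

variable {P} in
/-- For an operator of order at most one, `f ↦ [P, f] u` is a derivation. -/
theorem IsFirstOrder.comm_mul (hP : IsFirstOrder P) :
    comm P (f * g) u = mulSection f (comm P g u) + mulSection g (comm P f u) := by
  have h : mulSection (f * g) u = mulSection f (mulSection g u) := by
    ext x; simp [mul_smul]
  ext x
  have h0 : comm (comm P f) g u x = 0 := by rw [hP f g u]; rfl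
  simp only [comm_apply] at h0
  rw [sub_eq_zero, sub_eq_iff_eq_add] at h0
  simp only [comm_apply, ContMDiffSection.coe_add, Pi.add_apply, mulSection_apply, h, h0,
    smul_sub, ContMDiffMap.coe_mul, Pi.mul_apply, mul_smul]
  abel

end FirstOrder

section ChartPull

variable {n : ℕ} {X : Type*} [TopologicalSpace X] [ChartedSpace (EuclideanSpace ℝ (Fin n)) X]

/-- A function of the coordinates near `x₀`, cut off by a smooth function `χ` that vanishes off
the chart and thereby extended by zero to the manifold. -/
noncomputable def chartPull [IsManifold (𝓡 n) ∞ X] (x₀ : X) (χ : C^∞⟮𝓡 n, X; ℝ⟯)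
    (hχ : tsupport χ ⊆ (chartAt (EuclideanSpace ℝ (Fin n)) x₀).source)
    (h : EuclideanSpace ℝ (Fin n) → ℝ) (hh : ContDiff ℝ ∞ h) : C^∞⟮𝓡 n, X; ℝ⟯ :=
  ⟨fun x => χ x * h (chartAt (EuclideanSpace ℝ (Fin n)) x₀ x), by
    refine contMDiff_of_tsupport fun x hx => ?_
    have hx' := hχ (closure_mono (Function.support_mul_subset_left _ _) hx)
    have h1 : ContMDiffAt (𝓡 n) (𝓡 n) ∞ (chartAt (EuclideanSpace ℝ (Fin n)) x₀) x :=
      (contMDiffOn_chart (I := 𝓡 n) (n := ∞) (x := x₀)).contMDiffAt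
        ((chartAt (EuclideanSpace ℝ (Fin n)) x₀).open_source.mem_nhds hx')
    exact χ.contMDiff.contMDiffAt.mul (hh.contMDiff.contMDiffAt.comp x h1)⟩

variable [IsManifold (𝓡 n) ∞ X]
  (x₀ : X) (χ : C^∞⟮𝓡 n, X; ℝ⟯)
    (hχ : tsupport χ ⊆ (chartAt (EuclideanSpace ℝ (Fin n)) x₀).source)

@[simp]
theorem chartPull_apply (h : EuclideanSpace ℝ (Fin n) → ℝ) (hh : ContDiff ℝ ∞ h) (x : X) :
    chartPull x₀ χ hχ h hh x = χ x * h (chartAt (EuclideanSpace ℝ (Fin n)) x₀ x) := rfl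

/-- The `j`-th coordinate of the chart at `x₀`, cut off by `χ`. -/
noncomputable def chartCoord (j : Fin n) : C^∞⟮𝓡 n, X; ℝ⟯ :=
  chartPull x₀ χ hχ (fun y => y j) (by fun_prop)

@[simp]
theorem chartCoord_apply (j : Fin n) (x : X) :
    chartCoord x₀ χ hχ j x = χ x * chartAt (EuclideanSpace ℝ (Fin n)) x₀ x j := rfl

variable
  {F₁ F₂ : Type*} [NormedAddCommGroup F₁] [NormedSpace ℝ F₁]
  [NormedAddCommGroup F₂] [NormedSpace ℝ F₂]
  {E₁ E₂ : X → Type*}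
  [∀ x, NormedAddCommGroup (E₁ x)] [∀ x, InnerProductSpace ℝ (E₁ x)]
  [∀ x, NormedAddCommGroup (E₂ x)] [∀ x, InnerProductSpace ℝ (E₂ x)]
  [TopologicalSpace (TotalSpace F₁ E₁)] [FiberBundle F₁ E₁] [VectorBundle ℝ F₁ E₁]
  [TopologicalSpace (TotalSpace F₂ E₂)] [FiberBundle F₂ E₂] [VectorBundle ℝ F₂ E₂]
  {P : SmoothSection (n := n) F₁ E₁ →ₗ[ℝ] SmoothSection (n := n) F₂ E₂}
  (hP : IsFirstOrder P) (e : SmoothSection (n := n) F₁ E₁)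

variable (P) in
/-- The zeroth order coefficient of `P` in the chart at `x₀`, on the multiples of the section `e`,
where the cutoff `χ` equals one. -/
noncomputable def coeffZero : SmoothSection (n := n) F₂ E₂ := P e + comm P χ e

variable (P) in
/-- The coefficient of the `j`-th partial derivative of `P` in the chart at `x₀`, on the multiples
of the section `e`, where the cutoff `χ` equals one. -/
noncomputable def coeffOne (j : Fin n) : SmoothSection (n := n) F₂ E₂ :=
  comm P (chartCoord x₀ χ hχ j) e - mulSection (chartCoord x₀ χ hχ j) (comm P χ e)

include hP in
/-- A derivation at a point is determined by its values on the coordinates: by Hadamard's lemma, a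
function of the coordinates is a constant plus a sum of products of a coordinate vanishing at the
point with a smooth function. The terms with `[P, χ]` account for the cutoff. -/
theorem comm_chartPull_of_eq_one (h : EuclideanSpace ℝ (Fin n) → ℝ) (hh : ContDiff ℝ ∞ h)
    (x : X) (hx : χ x = 1) :
    comm P (chartPull x₀ χ hχ h hh) e x =
      h (chartAt (EuclideanSpace ℝ (Fin n)) x₀ x) • comm P χ e x +
      ∑ j, fderiv ℝ h (chartAt (EuclideanSpace ℝ (Fin n)) x₀ x) (EuclideanSpace.single j 1) •
        coeffOne x₀ χ hχ P e j x := by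
  set φ := chartAt (EuclideanSpace ℝ (Fin n)) x₀
  obtain ⟨G, hG, hG1, hG2⟩ := exists_contDiff_hadamard hh (φ x)
  have hGj : ∀ j : Fin n, ContDiff ℝ ∞ fun y => G y (EuclideanSpace.single j 1) :=
    fun j => hG.clm_apply contDiff_const
  have hsum : ∀ v : EuclideanSpace ℝ (Fin n), v = ∑ j, v j • EuclideanSpace.single j (1 : ℝ) := by
    intro v
    ext k
    simp [Finset.sum_apply, Pi.single_apply]
  -- Hadamard's lemma, multiplied by `χ ^ 2` so that all factors are smooth on the manifold.
  have hid : χ * chartPull x₀ χ hχ h hh = h (φ x) • (χ * χ) +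
      ∑ j, (chartCoord x₀ χ hχ j + (-(φ x j)) • χ) *
        chartPull x₀ χ hχ (fun y => G y (EuclideanSpace.single j 1)) (hGj j) := by
    ext y
    have h1 := hG1 (φ y)
    have h2 : G (φ y) (φ y - φ x) =
        ∑ j, (φ y j - φ x j) * G (φ y) (EuclideanSpace.single j 1) := by
      conv_lhs => rw [hsum (φ y - φ x)]
      simp
    have hs : ∀ s : Fin n → C^∞⟮𝓡 n, X; ℝ⟯, (∑ j, s j) y = ∑ j, s j y := by
      intro s
      rw [← ContMDiffMap.coeFnAddMonoidHom_apply, map_sum, Finset.sum_apply]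
      rfl
    simp only [ContMDiffMap.coe_mul, Pi.mul_apply, chartPull_apply, ContMDiffMap.coe_add,
      Pi.add_apply, ContMDiffMap.coe_smul, Pi.smul_apply, smul_eq_mul, hs, chartCoord_apply]
    have h3 : h (φ y) = h (φ x) + ∑ j, (φ y j - φ x j) * G (φ y) (EuclideanSpace.single j 1) := by
      rw [← h2, ← h1]; ring
    change χ y * (χ y * h (φ y)) = h (φ x) * (χ y * χ y) + ∑ j, (χ y * φ y j + -φ x j * χ y) *
      (χ y * G (φ y) (EuclideanSpace.single j 1))
    rw [h3, mul_add, mul_add, Finset.mul_sum, Finset.mul_sum]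
    congr 1
    · ring
    · exact Finset.sum_congr rfl fun j _ => by ring
  have hD := congrArg (fun s => comm P s e x) hid
  simp only [hP.comm_mul, comm_add, comm_smul, comm_sum] at hD
  have hs : ∀ s : Fin n → SmoothSection (n := n) F₂ E₂, (∑ j, s j) x = ∑ j, s j x := by
    intro s
    rw [← ContMDiffSection.coeAddHom_apply, map_sum, Finset.sum_apply]
    rfl
  simp only [ContMDiffSection.coe_add, Pi.add_apply, mulSection_apply, hx, one_smul,
    ContMDiffSection.coe_smul, Pi.smul_apply, hs, chartPull_apply, ContMDiffMap.coe_add,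
    ContMDiffMap.coe_smul, chartCoord_apply, smul_eq_mul, one_mul, mul_one] at hD
  change comm P (chartPull x₀ χ hχ h hh) e x + h (φ x) • comm P χ e x =
    h (φ x) • (comm P χ e x + comm P χ e x) + ∑ j, ((φ x j + -φ x j) • _ +
      G (φ x) (EuclideanSpace.single j 1) • (comm P (chartCoord x₀ χ hχ j) e x +
      -φ x j • comm P χ e x)) at hD
  simp only [add_neg_cancel, zero_smul, zero_add, hG2] at hD
  rw [← eq_sub_iff_add_eq] at hD
  rw [hD, smul_add, add_sub_right_comm, add_sub_cancel_right]
  congr 1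
  refine Finset.sum_congr rfl fun j _ => ?_
  congr 1
  simp only [coeffOne, ContMDiffSection.coe_sub, Pi.sub_apply, mulSection_apply, chartCoord_apply,
    hx, one_mul, neg_smul]
  exact (sub_eq_add_neg _ _).symm

include hP in
/-- The coordinate expression of a first order operator `P`, on the multiples `f e` of a section
`e` by functions `f` that are supported where the cutoff `χ` equals one. -/
theorem apply_mulSection_chartPull (h : EuclideanSpace ℝ (Fin n) → ℝ) (hh : ContDiff ℝ ∞ h)
    (hsupp : ∀ y ∈ (chartAt (EuclideanSpace ℝ (Fin n)) x₀).source,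
      chartAt (EuclideanSpace ℝ (Fin n)) x₀ y ∈ tsupport h → χ y = 1) (x : X) :
    P (mulSection (chartPull x₀ χ hχ h hh) e) x =
      (χ x * h (chartAt (EuclideanSpace ℝ (Fin n)) x₀ x)) • coeffZero χ P e x +
      ∑ j, (χ x * fderiv ℝ h (chartAt (EuclideanSpace ℝ (Fin n)) x₀ x)
        (EuclideanSpace.single j 1)) • coeffOne x₀ χ hχ P e j x := by
  have hc := comm_apply P (chartPull x₀ χ hχ h hh) e x
  rw [eq_sub_iff_add_eq] at hc
  rw [← hc]
  simp only [coeffZero, ContMDiffSection.coe_add, Pi.add_apply, smul_add, chartPull_apply]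
  by_cases hx : χ x = 1
  · rw [comm_chartPull_of_eq_one x₀ χ hχ hP e h hh x hx]
    simp only [hx, one_mul]
    abel
  · have hmul : chartPull x₀ χ hχ h hh = chartPull x₀ χ hχ h hh * χ := by
      ext y
      simp only [ContMDiffMap.coe_mul, Pi.mul_apply, chartPull_apply]
      by_cases hy : χ y = 0
      · simp [hy]
      by_cases hhy : h (chartAt (EuclideanSpace ℝ (Fin n)) x₀ y) = 0
      · simp [hhy]
      · rw [hsupp y (hχ (subset_tsupport _ hy)) (subset_tsupport _ hhy), mul_one]
    have hz : χ x = 0 ∨ chartAt (EuclideanSpace ℝ (Fin n)) x₀ x ∉ tsupport h := by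
      by_contra! hcon
      exact hx (hsupp x (hχ (subset_tsupport _ hcon.1)) hcon.2)
    have h0 : χ x * h (chartAt (EuclideanSpace ℝ (Fin n)) x₀ x) = 0 := by
      rcases hz with hz | hz
      · simp [hz]
      · simp [image_eq_zero_of_notMem_tsupport hz]
    have h1 : ∀ v, χ x * fderiv ℝ h (chartAt (EuclideanSpace ℝ (Fin n)) x₀ x) v = 0 := by
      intro v
      rcases hz with hz | hz
      · simp [hz]
      · have : fderiv ℝ h (chartAt (EuclideanSpace ℝ (Fin n)) x₀ x) = 0 := by
          by_contra hne
          exact hz (support_fderiv_subset ℝ hne)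
        simp [this]
    have h2 := congrArg (fun s => comm P s e x) hmul
    simp only [hP.comm_mul, ContMDiffSection.coe_add, Pi.add_apply, mulSection_apply,
      chartPull_apply, h0, zero_smul, zero_add] at h2
    have h3 : (1 - χ x) • comm P (chartPull x₀ χ hχ h hh) e x = 0 := by
      rw [sub_smul, one_smul, sub_eq_zero]
      exact h2
    have h4 : comm P (chartPull x₀ χ hχ h hh) e x = 0 :=
      (smul_eq_zero.1 h3).resolve_left (sub_ne_zero.2 (Ne.symm hx))
    simp [h0, h1, h4]

end ChartPull

/-! ### Limits of smooth sections in the graph norm -/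

section ContinuousSections

variable {X : Type*} [TopologicalSpace X]
  {F : Type*} [NormedAddCommGroup F] [NormedSpace ℝ F]
  {E : X → Type*} [∀ x, NormedAddCommGroup (E x)] [∀ x, InnerProductSpace ℝ (E x)]
  [TopologicalSpace (TotalSpace F E)] [FiberBundle F E] [VectorBundle ℝ F E]

theorem continuousOn_norm_bundle [IsContinuousRiemannianBundle F E] {Y : Type*}
    [TopologicalSpace Y] {b : Y → X} {s : ∀ y, E (b y)} {A : Set Y}
    (hs : ContinuousOn (fun y => TotalSpace.mk' F (b y) (s y)) A) :
    ContinuousOn (fun y => ‖s y‖) A := by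
  simp_rw [norm_eq_sqrt_real_inner]
  exact (hs.inner_bundle hs).sqrt

theorem continuous_norm_section [IsContinuousRiemannianBundle F E] {s : ∀ x, E x}
    (hs : Continuous fun x => TotalSpace.mk' F x (s x)) : Continuous fun x => ‖s x‖ := by
  simp_rw [norm_eq_sqrt_real_inner]
  exact (hs.inner_bundle hs).sqrt

theorem exists_norm_section_le [CompactSpace X] [IsContinuousRiemannianBundle F E]
    {s : ∀ x, E x} (hs : Continuous fun x => TotalSpace.mk' F x (s x)) :
    ∃ C : ℝ, 0 ≤ C ∧ ∀ x, ‖s x‖ ≤ C := by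
  obtain ⟨C, hC⟩ := isCompact_univ.exists_bound_of_continuousOn
    (continuous_norm_section hs).continuousOn
  exact ⟨max C 0, le_max_right _ _, fun x => by
    simpa using Or.inl (by simpa using hC x (mem_univ x))⟩

theorem continuous_add_section (n : ℕ) [ChartedSpace (EuclideanSpace ℝ (Fin n)) X]
    {s t : ∀ x, E x}
    (hs : Continuous fun x => TotalSpace.mk' F x (s x))
    (ht : Continuous fun x => TotalSpace.mk' F x (t x)) :
    Continuous fun x => TotalSpace.mk' F x (s x + t x) :=
  (((contMDiff_zero_iff (I := 𝓡 n)).2 hs).add_section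
    ((contMDiff_zero_iff (I := 𝓡 n)).2 ht)).continuous

theorem continuous_sub_section (n : ℕ) [ChartedSpace (EuclideanSpace ℝ (Fin n)) X]
    {s t : ∀ x, E x}
    (hs : Continuous fun x => TotalSpace.mk' F x (s x))
    (ht : Continuous fun x => TotalSpace.mk' F x (t x)) :
    Continuous fun x => TotalSpace.mk' F x (s x - t x) :=
  (((contMDiff_zero_iff (I := 𝓡 n)).2 hs).sub_section
    ((contMDiff_zero_iff (I := 𝓡 n)).2 ht)).continuous

theorem continuous_smul_section (n : ℕ) [ChartedSpace (EuclideanSpace ℝ (Fin n)) X]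
    {f : X → ℝ} {s : ∀ x, E x} (hf : Continuous f)
    (hs : Continuous fun x => TotalSpace.mk' F x (s x)) :
    Continuous fun x => TotalSpace.mk' F x (f x • s x) :=
  (((contMDiff_zero_iff (I := 𝓡 n)).2 hf).smul_section
    ((contMDiff_zero_iff (I := 𝓡 n)).2 hs)).continuous

theorem continuous_sum_section (n : ℕ) [ChartedSpace (EuclideanSpace ℝ (Fin n)) X]
    {ι : Type*} {A : Finset ι} {s : ι → ∀ x, E x}
    (hs : ∀ i ∈ A, Continuous fun x => TotalSpace.mk' F x (s i x)) :
    Continuous fun x => TotalSpace.mk' F x (∑ i ∈ A, s i x) :=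
  (ContMDiff.sum_section (I := 𝓡 n) (n := 0)
    fun i hi => contMDiff_zero_iff.2 (hs i hi)).continuous

variable (F E) in
theorem continuous_zero_section (n : ℕ) [ChartedSpace (EuclideanSpace ℝ (Fin n)) X] :
    Continuous fun x => TotalSpace.mk' F x (0 : E x) := by
  simpa using continuous_sum_section n (A := (∅ : Finset ℕ)) (s := fun _ x => (0 : E x))
    (F := F) (by simp)

end ContinuousSections

section Approx

variable {n : ℕ} {X : Type*} [TopologicalSpace X] [ChartedSpace (EuclideanSpace ℝ (Fin n)) X]
  {F F₁ F₂ : Type*} [NormedAddCommGroup F] [NormedSpace ℝ F]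
  [NormedAddCommGroup F₁] [NormedSpace ℝ F₁] [NormedAddCommGroup F₂] [NormedSpace ℝ F₂]
  {E E₁ E₂ : X → Type*}
  [∀ x, NormedAddCommGroup (E x)] [∀ x, InnerProductSpace ℝ (E x)]
  [∀ x, NormedAddCommGroup (E₁ x)] [∀ x, InnerProductSpace ℝ (E₁ x)]
  [∀ x, NormedAddCommGroup (E₂ x)] [∀ x, InnerProductSpace ℝ (E₂ x)]
  [TopologicalSpace (TotalSpace F E)] [FiberBundle F E] [VectorBundle ℝ F E]
  [TopologicalSpace (TotalSpace F₁ E₁)] [FiberBundle F₁ E₁] [VectorBundle ℝ F₁ E₁]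
  [TopologicalSpace (TotalSpace F₂ E₂)] [FiberBundle F₂ E₂] [VectorBundle ℝ F₂ E₂]

theorem continuous_mul_comp_chart {χ : X → ℝ} (hχc : Continuous χ) {x₀ : X}
    (hχ : tsupport χ ⊆ (chartAt (EuclideanSpace ℝ (Fin n)) x₀).source)
    {h : EuclideanSpace ℝ (Fin n) → ℝ} (hh : Continuous h) :
    Continuous fun x => χ x * h (chartAt (EuclideanSpace ℝ (Fin n)) x₀ x) := by
  refine continuous_iff_continuousAt.2 fun x => ?_
  by_cases hx : x ∈ tsupport χ
  · exact hχc.continuousAt.mul (hh.continuousAt.comp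
      ((chartAt (EuclideanSpace ℝ (Fin n)) x₀).continuousAt (hχ hx)))
  · refine (continuousAt_const (y := (0 : ℝ))).congr ?_
    filter_upwards [notMem_tsupport_iff_eventuallyEq.1 hx] with y hy
    simp [hy]

/-- A first order operator applied to `f e`, where `e` is a smooth section and `f` a `C^1` function
in a chart, is defined as a limit: it depends continuously on `f` with respect to the `C^1` norm. -/
theorem exists_lim_apply_mulSection_chartPull [CompactSpace X] [IsManifold (𝓡 n) ∞ X]
    [IsContinuousRiemannianBundle F₁ E₁] (x₀ : X) (χ : C^∞⟮𝓡 n, X; ℝ⟯)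
    (hχ : tsupport χ ⊆ (chartAt (EuclideanSpace ℝ (Fin n)) x₀).source)
    {P : SmoothSection (n := n) F E →ₗ[ℝ] SmoothSection (n := n) F₁ E₁}
    (hP : IsFirstOrder P) (e : SmoothSection (n := n) F E)
    {f : EuclideanSpace ℝ (Fin n) → ℝ} (hf : ContDiff ℝ 1 f)
    {W : Set (EuclideanSpace ℝ (Fin n))}
    (hW : ∀ y ∈ (chartAt (EuclideanSpace ℝ (Fin n)) x₀).source,
      chartAt (EuclideanSpace ℝ (Fin n)) x₀ y ∈ W → χ y = 1) :
    ∃ g : ∀ x, E₁ x, Continuous (fun x => TotalSpace.mk' F₁ x (g x)) ∧ ∃ C : ℝ, 0 ≤ C ∧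
      ∀ (h : EuclideanSpace ℝ (Fin n) → ℝ) (hh : ContDiff ℝ ∞ h) (ε : ℝ), 0 ≤ ε →
        tsupport h ⊆ W → (∀ y, |h y - f y| ≤ ε) →
        (∀ y, ‖fderiv ℝ h y - fderiv ℝ f y‖ ≤ ε) →
        ∀ x, ‖P (mulSection (chartPull x₀ χ hχ h hh) e) x - g x‖ ≤ C * ε := by
  obtain ⟨K, hK⟩ := isCompact_univ.exists_bound_of_continuousOn
    χ.contMDiff.continuous.continuousOn
  replace hK : ∀ x, |χ x| ≤ max K 0 := fun x => (hK x (mem_univ x)).trans (le_max_left _ _)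
  obtain ⟨M₀, hM₀0, hM₀⟩ := exists_norm_section_le (coeffZero χ P e).contMDiff.continuous
  choose M₁ hM₁0 hM₁ using fun j =>
    exists_norm_section_le (coeffOne x₀ χ hχ P e j).contMDiff.continuous
  have hfd : Continuous (fderiv ℝ f) := hf.continuous_fderiv one_ne_zero
  refine ⟨fun x => (χ x * f (chartAt (EuclideanSpace ℝ (Fin n)) x₀ x)) • coeffZero χ P e x +
      ∑ j, (χ x * fderiv ℝ f (chartAt (EuclideanSpace ℝ (Fin n)) x₀ x)
        (EuclideanSpace.single j 1)) • coeffOne x₀ χ hχ P e j x, ?_,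
      max K 0 * (M₀ + ∑ j, M₁ j), by
        have := Finset.sum_nonneg fun j (_ : j ∈ Finset.univ) => hM₁0 j
        positivity, ?_⟩
  · refine continuous_add_section n ?_ (continuous_sum_section n fun j _ => ?_)
    · exact continuous_smul_section n
        (continuous_mul_comp_chart χ.contMDiff.continuous hχ hf.continuous)
        (coeffZero χ P e).contMDiff.continuous
    · exact continuous_smul_section n
        (continuous_mul_comp_chart (h := fun y => fderiv ℝ f y (EuclideanSpace.single j 1))
          χ.contMDiff.continuous hχ (hfd.clm_apply continuous_const))
        (coeffOne x₀ χ hχ P e j).contMDiff.continuous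
  · intro h hh ε hε hhW h0 h1 x
    rw [apply_mulSection_chartPull x₀ χ hχ hP e h hh (fun y hy hy' => hW y hy (hhW hy')) x,
      add_sub_add_comm, ← Finset.sum_sub_distrib]
    simp only [← sub_smul, ← mul_sub]
    have hz : ∀ (a b : ℝ) (v : E₁ x) (M : ℝ), |b| ≤ ε → |a| ≤ max K 0 → ‖v‖ ≤ M →
        ‖(a * b) • v‖ ≤ max K 0 * M * ε := by
      intro a b v M hb ha hv
      rw [norm_smul, Real.norm_eq_abs, abs_mul]
      calc |a| * |b| * ‖v‖ ≤ max K 0 * ε * M := by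
            gcongr
        _ = _ := by ring
    refine (norm_add_le _ _).trans ?_
    calc _ ≤ max K 0 * M₀ * ε + ∑ j, max K 0 * M₁ j * ε := by
          refine add_le_add (hz _ _ _ _ (h0 _) (hK x) (hM₀ x)) ((norm_sum_le _ _).trans
            (Finset.sum_le_sum fun j _ => hz _ _ _ _ ?_ (hK x) (hM₁ j x)))
          rw [← sub_apply, ← Real.norm_eq_abs]
          refine (ContinuousLinearMap.le_opNorm _ _).trans ?_
          simpa using h1 _
      _ = _ := by
          rw [← Finset.sum_mul, ← Finset.mul_sum]; ring

/-- `u` is a uniform limit of smooth sections `φ` such that `P φ` and `Q φ` converge uniformly to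
`g` and `k`. -/
def IsLimOfSmooth (P : SmoothSection (n := n) F E →ₗ[ℝ] SmoothSection (n := n) F₁ E₁)
    (Q : SmoothSection (n := n) F E →ₗ[ℝ] SmoothSection (n := n) F₂ E₂)
    (u : ∀ x, E x) (g : ∀ x, E₁ x) (k : ∀ x, E₂ x) : Prop :=
  ∀ ε > 0, ∃ φ : SmoothSection (n := n) F E,
    ∀ x, ‖φ x - u x‖ ≤ ε ∧ ‖P φ x - g x‖ ≤ ε ∧ ‖Q φ x - k x‖ ≤ ε

variable {P : SmoothSection (n := n) F E →ₗ[ℝ] SmoothSection (n := n) F₁ E₁}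
    {Q : SmoothSection (n := n) F E →ₗ[ℝ] SmoothSection (n := n) F₂ E₂}

theorem exists_isLimOfSmooth_sum {ι : Type*} (A : Finset ι) {u : ι → ∀ x, E x}
    (h : ∀ i ∈ A, ∃ g k, Continuous (fun x => TotalSpace.mk' F₁ x (g x)) ∧
      Continuous (fun x => TotalSpace.mk' F₂ x (k x)) ∧ IsLimOfSmooth P Q (u i) g k) :
    ∃ g k, Continuous (fun x => TotalSpace.mk' F₁ x (g x)) ∧
      Continuous (fun x => TotalSpace.mk' F₂ x (k x)) ∧
      IsLimOfSmooth P Q (fun x => ∑ i ∈ A, u i x) g k := by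
  classical
  induction A using Finset.induction_on with
  | empty =>
    exact ⟨_, _, continuous_zero_section F₁ E₁ n, continuous_zero_section F₂ E₂ n,
      fun ε hε => ⟨0, fun x => by simp [hε.le]⟩⟩
  | insert a A ha ih =>
    obtain ⟨g, k, hg, hk, hgk⟩ := ih fun i hi => h i (Finset.mem_insert_of_mem hi)
    obtain ⟨g', k', hg', hk', hgk'⟩ := h a (Finset.mem_insert_self a A)
    refine ⟨_, _, continuous_add_section n hg' hg, continuous_add_section n hk' hk,
      fun ε hε => ?_⟩
    obtain ⟨φ, hφ⟩ := hgk (ε / 2) (half_pos hε)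
    obtain ⟨φ', hφ'⟩ := hgk' (ε / 2) (half_pos hε)
    refine ⟨φ' + φ, fun x => ?_⟩
    simp only [map_add, ContMDiffSection.coe_add, Pi.add_apply, add_sub_add_comm,
      Finset.sum_insert ha]
    refine ⟨?_, ?_, ?_⟩ <;> refine (norm_add_le _ _).trans ?_
    · linarith [(hφ x).1, (hφ' x).1]
    · linarith [(hφ x).2.1, (hφ' x).2.1]
    · linarith [(hφ x).2.2, (hφ' x).2.2]

end Approx

/-! ### Approximation of `C^1` sections -/

section ApproxC1

variable {n : ℕ} {X : Type*} [TopologicalSpace X] [ChartedSpace (EuclideanSpace ℝ (Fin n)) X]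
  [T2Space X] [CompactSpace X] [IsManifold (𝓡 n) ∞ X]
  {F F₁ F₂ : Type*} [NormedAddCommGroup F] [NormedSpace ℝ F]
  [NormedAddCommGroup F₁] [NormedSpace ℝ F₁] [NormedAddCommGroup F₂] [NormedSpace ℝ F₂]
  {E E₁ E₂ : X → Type*}
  [∀ x, NormedAddCommGroup (E x)] [∀ x, InnerProductSpace ℝ (E x)]
  [∀ x, NormedAddCommGroup (E₁ x)] [∀ x, InnerProductSpace ℝ (E₁ x)]
  [∀ x, NormedAddCommGroup (E₂ x)] [∀ x, InnerProductSpace ℝ (E₂ x)]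
  [TopologicalSpace (TotalSpace F E)] [FiberBundle F E] [VectorBundle ℝ F E]
  [TopologicalSpace (TotalSpace F₁ E₁)] [FiberBundle F₁ E₁] [VectorBundle ℝ F₁ E₁]
  [TopologicalSpace (TotalSpace F₂ E₂)] [FiberBundle F₂ E₂] [VectorBundle ℝ F₂ E₂]
  [ContMDiffVectorBundle ∞ F E (𝓡 n)]
  [IsContinuousRiemannianBundle F E] [IsContinuousRiemannianBundle F₁ E₁]
  [IsContinuousRiemannianBundle F₂ E₂]
  {P : SmoothSection (n := n) F E →ₗ[ℝ] SmoothSection (n := n) F₁ E₁}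
  {Q : SmoothSection (n := n) F E →ₗ[ℝ] SmoothSection (n := n) F₂ E₂}
  (hP : IsFirstOrder P) (hQ : IsFirstOrder Q)

omit [T2Space X] [ContMDiffVectorBundle ∞ F E (𝓡 n)] in
include hP hQ in
theorem exists_isLimOfSmooth_chart (x₀ : X) (χ : C^∞⟮𝓡 n, X; ℝ⟯)
    (hχ : tsupport χ ⊆ (chartAt (EuclideanSpace ℝ (Fin n)) x₀).source)
    (e : SmoothSection (n := n) F E)
    {f : EuclideanSpace ℝ (Fin n) → ℝ} (hf : ContDiff ℝ 1 f) (hfc : HasCompactSupport f)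
    {W : Set (EuclideanSpace ℝ (Fin n))} (hWo : IsOpen W) (hfW : tsupport f ⊆ W)
    (hW : ∀ y ∈ (chartAt (EuclideanSpace ℝ (Fin n)) x₀).source,
      chartAt (EuclideanSpace ℝ (Fin n)) x₀ y ∈ W → χ y = 1) :
    ∃ g k, Continuous (fun x => TotalSpace.mk' F₁ x (g x)) ∧
      Continuous (fun x => TotalSpace.mk' F₂ x (k x)) ∧
      IsLimOfSmooth P Q
        (fun x => (χ x * f (chartAt (EuclideanSpace ℝ (Fin n)) x₀ x)) • e x) g k := by
  obtain ⟨g, hg, C, hC0, hC⟩ := exists_lim_apply_mulSection_chartPull x₀ χ hχ hP e hf hW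
  obtain ⟨k, hk, C', hC'0, hC'⟩ := exists_lim_apply_mulSection_chartPull x₀ χ hχ hQ e hf hW
  obtain ⟨K, hK0, hK⟩ := exists_norm_section_le (mulSection χ e).contMDiff.continuous
  refine ⟨g, k, hg, hk, fun ε hε => ?_⟩
  have hS : 0 < C + C' + K + 1 := by positivity
  obtain ⟨h, hh, hhW, h0, h1⟩ := exists_contDiff_C1_approx hf hfc hWo hfW (div_pos hε hS)
  have hle : ∀ c, c ≤ C + C' + K → c * (ε / (C + C' + K + 1)) ≤ ε := by
    intro c hc
    rw [mul_div_assoc', div_le_iff₀ hS]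
    nlinarith
  refine ⟨mulSection (chartPull x₀ χ hχ h hh) e, fun x => ⟨?_, ?_, ?_⟩⟩
  · rw [mulSection_apply, chartPull_apply, ← sub_smul, ← mul_sub, mul_comm, mul_smul, norm_smul]
    refine le_trans ?_ (hle K (by linarith))
    rw [mul_comm K]
    exact mul_le_mul (h0 _) (hK x) (norm_nonneg _) (by positivity)
  · exact (hC h hh _ (by positivity) hhW h0 h1 x).trans (hle C (by linarith))
  · exact (hC' h hh _ (by positivity) hhW h0 h1 x).trans (hle C' (by linarith))

omit [T2Space X] [CompactSpace X] [VectorBundle ℝ F E] [ContMDiffVectorBundle ∞ F E (𝓡 n)]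
  [IsContinuousRiemannianBundle F E] [∀ x, InnerProductSpace ℝ (E x)] in
/-- A cut off coefficient function of a `C^1` section is `C^1` in the chart. -/
theorem contDiff_indicator_mul_localRep (x₀ : X) (ρ : C^∞⟮𝓡 n, X; ℝ⟯)
    (hρ : tsupport ρ ⊆ (chartAt (EuclideanSpace ℝ (Fin n)) x₀).source ∩
      (trivializationAt F E x₀).baseSet) {u : ∀ x, E x}
    (hu : ContDiffOn ℝ 1 (localRep (n := n) F x₀ u) (localDom F E x₀)) (l : F →L[ℝ] ℝ)
    (hcl : IsClosed (chartAt (EuclideanSpace ℝ (Fin n)) x₀ '' tsupport ρ)) :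
    ContDiff ℝ 1 (indicator (chartAt (EuclideanSpace ℝ (Fin n)) x₀).target fun y =>
      ρ ((chartAt (EuclideanSpace ℝ (Fin n)) x₀).symm y) * l (localRep F x₀ u y)) := by
  set φ := chartAt (EuclideanSpace ℝ (Fin n)) x₀
  have hopen : IsOpen (localDom F E x₀ : Set (EuclideanSpace ℝ (Fin n))) :=
    φ.symm.isOpen_inter_preimage (trivializationAt F E x₀).open_baseSet
  refine contDiff_iff_contDiffAt.2 fun y => ?_
  by_cases hy : y ∈ φ '' tsupport ρ
  · have hyD : y ∈ localDom F E x₀ := by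
      obtain ⟨x, hx, rfl⟩ := hy
      refine ⟨φ.map_source (hρ hx).1, ?_⟩
      simpa [mem_preimage, φ, φ.left_inv (hρ hx).1] using (hρ hx).2
    have hs : ContDiffAt ℝ 1 (fun y => ρ (φ.symm y)) y := by
      have h1 : ContMDiffAt (𝓡 n) (𝓡 n) ∞ φ.symm y :=
        (contMDiffOn_chart_symm (I := 𝓡 n) (n := ∞) (x := x₀)).contMDiffAt
          (φ.open_target.mem_nhds hyD.1)
      have h2 : ContMDiffAt (𝓡 n) 𝓘(ℝ, ℝ) ∞ (fun y => ρ (φ.symm y)) y :=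
        ρ.contMDiff.contMDiffAt.comp y h1
      exact h2.contDiffAt.of_le (by simp)
    refine (hs.mul (l.contDiff.contDiffAt.comp y
      (hu.contDiffAt (hopen.mem_nhds hyD)))).congr_of_eventuallyEq ?_
    filter_upwards [φ.open_target.mem_nhds hyD.1] with z hz
    simp [hz]
  · refine (contDiffAt_const (c := (0 : ℝ))).congr_of_eventuallyEq ?_
    filter_upwards [hcl.isOpen_compl.mem_nhds hy] with z hz
    by_cases hzt : z ∈ φ.target
    · have : ρ (φ.symm z) = 0 := by
        by_contra hne
        exact hz ⟨φ.symm z, subset_tsupport _ hne, φ.right_inv hzt⟩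
      simp [this]
    · simp [hzt]

variable [FiniteDimensional ℝ F]

include hP hQ in
/-- A `C^1` section, cut off in the domain of a chart and a trivialization, is a limit of smooth
sections in the graph norm of first order operators. -/
theorem exists_isLimOfSmooth_smul (x₀ : X) (ρ : C^∞⟮𝓡 n, X; ℝ⟯)
    (hρ : tsupport ρ ⊆ (chartAt (EuclideanSpace ℝ (Fin n)) x₀).source ∩
      (trivializationAt F E x₀).baseSet) {u : ∀ x, E x}
    (hu : ContDiffOn ℝ 1 (localRep (n := n) F x₀ u) (localDom F E x₀)) :
    ∃ g k, Continuous (fun x => TotalSpace.mk' F₁ x (g x)) ∧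
      Continuous (fun x => TotalSpace.mk' F₂ x (k x)) ∧
      IsLimOfSmooth P Q (fun x => ρ x • u x) g k := by
  set φ := chartAt (EuclideanSpace ℝ (Fin n)) x₀ with hφ
  set τ := trivializationAt F E x₀ with hτ
  let b := Module.finBasis ℝ F
  have hO : IsOpen (φ.source ∩ τ.baseSet) := φ.open_source.inter τ.open_baseSet
  obtain ⟨t, hto, hst, htO⟩ := normal_exists_closure_subset (isClosed_tsupport ρ) hO hρ
  obtain ⟨χ, hχ1, hχ0, -⟩ := exists_contMDiffMap_one_nhds_of_subset_interior (n := ⊤) (𝓡 n)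
    (isClosed_tsupport ρ) (t := closure t) (hst.trans (hto.subset_interior_iff.2 subset_closure))
  have hχt : tsupport χ ⊆ closure t := closure_minimal
    (fun x hx => by_contra fun hxt => hx (hχ0 x hxt)) isClosed_closure
  have hχs : tsupport χ ⊆ φ.source := fun x hx => (htO (hχt hx)).1
  have hcomp : IsCompact (φ '' tsupport ρ) :=
    (isClosed_tsupport ρ).isCompact.image_of_continuousOn
      (φ.continuousOn.mono fun x hx => (hρ hx).1)
  -- the cut off frame, and the coefficients of the section
  let e : Fin (Module.finrank ℝ F) → SmoothSection (n := n) F E := fun j =>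
    ⟨fun x => χ x • τ.localFrame b j x,
      ContMDiffOn.smul_section_of_tsupport χ.contMDiff.contMDiffOn hO (hχt.trans htO)
        ((τ.contMDiffOn_localFrame_baseSet (I := 𝓡 n) ∞ b j).mono inter_subset_right)⟩
  let l : Fin (Module.finrank ℝ F) → (F →L[ℝ] ℝ) := fun j => (b.coord j).toContinuousLinearMap
  let f : Fin (Module.finrank ℝ F) → EuclideanSpace ℝ (Fin n) → ℝ := fun j =>
    indicator φ.target fun y => ρ (φ.symm y) * l j (localRep F x₀ u y)
  have hf : ∀ j, ContDiff ℝ 1 (f j) := fun j =>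
    contDiff_indicator_mul_localRep x₀ ρ hρ hu (l j) hcomp.isClosed
  have hfs : ∀ j, tsupport (f j) ⊆ φ '' tsupport ρ := by
    intro j
    refine closure_minimal (fun y hy => ?_) hcomp.isClosed
    have hyt : y ∈ φ.target := by
      by_contra h
      exact hy (indicator_of_notMem h _)
    have hy0 : ρ (φ.symm y) ≠ 0 := by
      intro h
      exact hy (by simp [f, h])
    exact ⟨φ.symm y, subset_tsupport _ hy0, φ.right_inv hyt⟩
  let W := φ.target ∩ φ.symm ⁻¹' interior {x | χ x = 1}
  have hWo : IsOpen W := φ.symm.isOpen_inter_preimage isOpen_interior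
  have hρ1 : ∀ x ∈ tsupport ρ, x ∈ interior {x | χ x = 1} := fun x hx =>
    mem_interior_iff_mem_nhds.2 (Filter.mem_of_superset (mem_nhdsSet_iff_forall.1 hχ1 x hx)
      fun y hy => hy)
  have hfW : ∀ j, tsupport (f j) ⊆ W := by
    intro j y hy
    obtain ⟨x, hx, rfl⟩ := hfs j hy
    refine ⟨φ.map_source (hρ hx).1, ?_⟩
    rw [mem_preimage, φ.left_inv (hρ hx).1]
    exact hρ1 x hx
  have hW : ∀ y ∈ φ.source, φ y ∈ W → χ y = 1 := by
    intro y hy hyW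
    have := interior_subset hyW.2
    rwa [φ.left_inv hy] at this
  have key := exists_isLimOfSmooth_sum (P := P) (Q := Q) Finset.univ fun j _ =>
    exists_isLimOfSmooth_chart hP hQ x₀ χ hχs (e j) (hf j)
      (HasCompactSupport.of_support_subset_isCompact hcomp ((subset_tsupport _).trans (hfs j)))
      hWo (hfW j) hW
  convert key using 7 with x
  funext x
  by_cases hx : ρ x = 0
  · have h0 : ∀ j, χ x * f j (φ x) = 0 := by
      intro j
      by_cases hxs : x ∈ φ.source
      · simp [f, φ.map_source hxs, φ.left_inv hxs, hx]
      · have : χ x = 0 := by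
          by_contra h
          exact hxs (hχs (subset_tsupport _ h))
        simp [this]
    simp [hx, ← hφ, h0]
  · have hxρ := subset_tsupport _ hx
    have hxO := hρ hxρ
    have hχx : χ x = 1 := (interior_subset (hρ1 x hxρ) : x ∈ {x | χ x = 1})
    have hrep : u x = ∑ j, b.repr (τ ⟨x, u x⟩).2 j • τ.localFrame b j x := by
      conv_lhs => rw [← (τ.basisAt b hxO.2).sum_repr (u x)]
      refine Finset.sum_congr rfl fun j _ => ?_
      rw [τ.localFrame_apply_of_mem_baseSet b hxO.2]
      simp [Trivialization.basisAt]
    conv_lhs => rw [hrep]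
    rw [Finset.smul_sum]
    refine Finset.sum_congr rfl fun j _ => ?_
    have he : e j x = τ.localFrame b j x := by
      have h : e j x = χ x • τ.localFrame b j x := rfl
      rw [h, hχx, one_smul]
    have hfj : f j (φ x) = ρ x * b.repr (τ ⟨x, u x⟩).2 j := by
      simp only [f, indicator_of_mem (φ.map_source hxO.1), φ.left_inv hxO.1]
      have h : ∀ z, z = x → b.coord j (τ ⟨z, u z⟩).2 = b.repr (τ ⟨x, u x⟩).2 j := by
        rintro _ rfl
        rfl
      exact congrArg (ρ x * ·) (h _ (φ.left_inv hxO.1))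
    rw [← hφ, he, hfj, hχx, one_mul, mul_smul]

include hP hQ in
/-- On a compact manifold, a `C^1` section is a limit of smooth sections in the graph norm of first
order operators. -/
theorem exists_isLimOfSmooth {u : ∀ x, E x}
    (hu : ∀ x₀, ContDiffOn ℝ 1 (localRep (n := n) F x₀ u) (localDom F E x₀)) :
    ∃ g k, Continuous (fun x => TotalSpace.mk' F₁ x (g x)) ∧
      Continuous (fun x => TotalSpace.mk' F₂ x (k x)) ∧ IsLimOfSmooth P Q u g k := by
  obtain ⟨ρ, hρ⟩ := SmoothPartitionOfUnity.exists_isSubordinate (𝓡 n) isClosed_univ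
    (fun x₀ : X => (chartAt (EuclideanSpace ℝ (Fin n)) x₀).source ∩
      (trivializationAt F E x₀).baseSet)
    (fun x₀ => (chartAt (EuclideanSpace ℝ (Fin n)) x₀).open_source.inter
      (trivializationAt F E x₀).open_baseSet)
    (fun x _ => mem_iUnion.2 ⟨x, mem_chart_source _ x,
      FiberBundle.mem_baseSet_trivializationAt' x⟩)
  have hfin : {i | (Function.support (ρ i)).Nonempty}.Finite :=
    ρ.locallyFinite.finite_nonempty_of_compact
  have key := exists_isLimOfSmooth_sum (P := P) (Q := Q) hfin.toFinset fun i _ =>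
    exists_isLimOfSmooth_smul hP hQ i (ρ i) (hρ i) (hu i)
  convert key using 7 with x
  funext x
  rw [← Finset.sum_smul, ρ.sum_finsupport' x (mem_univ x), one_smul]
  intro i hi
  rw [ρ.mem_finsupport] at hi
  exact hfin.mem_toFinset.2 ⟨x, hi⟩

end ApproxC1

/-! ### Smooth volumes and the pairing of sections -/

section Volume

variable {n : ℕ} {X : Type*} [TopologicalSpace X] [ChartedSpace (EuclideanSpace ℝ (Fin n)) X]
  [MeasurableSpace X] [BorelSpace X] {ν : Measure X}

/-- The formula for a smooth volume in a chart. -/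
theorem IsSmoothVolume.exists_lintegral (hν : IsSmoothVolume (n := n) ν) (x₀ : X) :
    ∃ ρ : EuclideanSpace ℝ (Fin n) → ℝ,
      ContinuousOn ρ (chartAt (EuclideanSpace ℝ (Fin n)) x₀).target ∧
      (∀ y ∈ (chartAt (EuclideanSpace ℝ (Fin n)) x₀).target, 0 < ρ y) ∧
      ∀ V ⊆ (chartAt (EuclideanSpace ℝ (Fin n)) x₀).target, MeasurableSet V →
        ν ((chartAt (EuclideanSpace ℝ (Fin n)) x₀).source ∩
          chartAt (EuclideanSpace ℝ (Fin n)) x₀ ⁻¹' V) = ∫⁻ y in V, ENNReal.ofReal (ρ y) := by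
  obtain ⟨ρ, h1, h2, h3⟩ := hν x₀
  refine ⟨ρ, h1.continuousOn, h2, fun V hV hVm => ?_⟩
  set φ := chartAt (EuclideanSpace ℝ (Fin n)) x₀
  have hm : AEMeasurable φ (ν.restrict φ.source) :=
    φ.continuousOn.aemeasurable φ.open_source.measurableSet
  have h4 := congrArg (fun m => m V) h3
  rw [Measure.map_apply_of_aemeasurable hm hVm, withDensity_apply _ hVm,
    Measure.restrict_restrict hVm, inter_eq_left.2 hV,
    Measure.restrict_apply' φ.open_source.measurableSet, inter_comm] at h4
  exact h4

theorem IsSmoothVolume.isFiniteMeasure [CompactSpace X] (hν : IsSmoothVolume (n := n) ν) :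
    IsFiniteMeasure ν := by
  have : IsLocallyFiniteMeasure ν := by
    refine ⟨fun x₀ => ?_⟩
    obtain ⟨ρ, h1, -, h3⟩ := hν.exists_lintegral x₀
    set φ := chartAt (EuclideanSpace ℝ (Fin n)) x₀
    obtain ⟨r, hr, hrs⟩ := Metric.nhds_basis_closedBall.mem_iff.1
      (φ.open_target.mem_nhds (φ.map_source (mem_chart_source _ x₀)))
    obtain ⟨C, hC⟩ := (isCompact_closedBall (φ x₀) r).exists_bound_of_continuousOn (h1.mono hrs)
    refine ⟨φ.source ∩ φ ⁻¹' Metric.closedBall (φ x₀) r, ?_, ?_⟩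
    · exact Filter.inter_mem (φ.open_source.mem_nhds (mem_chart_source _ x₀))
        ((φ.continuousAt (mem_chart_source _ x₀)).preimage_mem_nhds
          (Metric.closedBall_mem_nhds _ hr))
    · rw [h3 _ hrs Metric.isClosed_closedBall.measurableSet]
      calc ∫⁻ y in Metric.closedBall (φ x₀) r, ENNReal.ofReal (ρ y)
          ≤ ∫⁻ _ in Metric.closedBall (φ x₀) r, ENNReal.ofReal C :=
            setLIntegral_mono' Metric.isClosed_closedBall.measurableSet fun y hy =>
              ENNReal.ofReal_le_ofReal ((le_abs_self _).trans (hC y hy))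
        _ < ⊤ := by
            rw [setLIntegral_const]
            exact ENNReal.mul_lt_top ENNReal.ofReal_lt_top measure_closedBall_lt_top
  infer_instance

theorem IsSmoothVolume.isOpenPosMeasure (hν : IsSmoothVolume (n := n) ν) :
    ν.IsOpenPosMeasure := by
  refine ⟨fun U hU ⟨x₀, hx₀⟩ h0 => ?_⟩
  obtain ⟨ρ, h1, h2, h3⟩ := hν.exists_lintegral x₀
  set φ := chartAt (EuclideanSpace ℝ (Fin n)) x₀
  have hVo : IsOpen (φ.target ∩ φ.symm ⁻¹' U) := φ.symm.isOpen_inter_preimage hU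
  have hV := h3 _ inter_subset_left hVo.measurableSet
  have hsub : φ.source ∩ φ ⁻¹' (φ.target ∩ φ.symm ⁻¹' U) ⊆ U := by
    rintro x ⟨hx, -, hxU⟩
    rwa [mem_preimage, φ.left_inv hx] at hxU
  rw [measure_mono_null hsub h0] at hV
  have hρm : AEMeasurable (fun y => ENNReal.ofReal (ρ y))
      (volume.restrict (φ.target ∩ φ.symm ⁻¹' U)) :=
    ((h1.mono inter_subset_left).aemeasurable hVo.measurableSet).ennreal_ofReal
  have hae := (lintegral_eq_zero_iff' hρm).1 hV.symm
  have hae' := (ae_restrict_iff' hVo.measurableSet).1 hae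
  have hnull : volume (φ.target ∩ φ.symm ⁻¹' U) = 0 := by
    refine measure_mono_null (fun y hy => ?_) (ae_iff.1 hae')
    simp only [mem_ofPred_eq, Pi.zero_apply, ENNReal.ofReal_eq_zero, not_forall, not_le]
    exact ⟨hy, h2 y hy.1⟩
  refine (hVo.measure_pos volume ⟨φ x₀, ?_⟩).ne' hnull
  have hx := mem_chart_source (EuclideanSpace ℝ (Fin n)) x₀
  refine ⟨φ.map_source hx, ?_⟩
  rwa [mem_preimage, φ.left_inv hx]

end Volume

section Bounds

variable {X : Type*} [MeasurableSpace X] {ν : Measure X} [IsFiniteMeasure ν]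
  {E : X → Type*} [∀ x, NormedAddCommGroup (E x)] [∀ x, InnerProductSpace ℝ (E x)]

/-- The bound needs no measurability of `a` and `b`. -/
theorem abs_integral_inner_le {a b : ∀ x, E x} {M ε : ℝ} (hM : 0 ≤ M)
    (ha : ∀ x, ‖a x‖ ≤ M) (hb : ∀ x, ‖b x‖ ≤ ε) :
    |∫ x, ⟪a x, b x⟫_ℝ ∂ν| ≤ M * ε * ν.real univ := by
  have h := norm_integral_le_of_norm_le (μ := ν) (f := fun x => ⟪a x, b x⟫_ℝ)
    (g := fun _ => M * ε) (integrable_const _)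
    (Filter.Eventually.of_forall fun x => (norm_inner_le_norm _ _).trans
      (mul_le_mul (ha x) (hb x) (norm_nonneg _) hM))
  rw [integral_const, smul_eq_mul, mul_comm] at h
  exact h

theorem tendsto_integral_inner_zero {a : ∀ x, E x} {M : ℝ} (ha : ∀ x, ‖a x‖ ≤ M)
    {b : ℕ → ∀ x, E x} {δ : ℕ → ℝ} (hδ : Filter.Tendsto δ Filter.atTop (𝓝 0))
    (hb : ∀ k x, ‖b k x‖ ≤ δ k) :
    Filter.Tendsto (fun k => ∫ x, ⟪a x, b k x⟫_ℝ ∂ν) Filter.atTop (𝓝 0) := by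
  refine squeeze_zero_norm (fun k => abs_integral_inner_le (le_max_right M 0)
    (fun x => (ha x).trans (le_max_left _ _)) (hb k)) ?_
  simpa using (hδ.const_mul (max M 0)).mul_const (ν.real univ)

end Bounds

section Pairing

variable {n : ℕ} {X : Type*} [TopologicalSpace X] [CompactSpace X]
  [MeasurableSpace X] [BorelSpace X] {ν : Measure X} [IsFiniteMeasure ν]
  {F : Type*} [NormedAddCommGroup F] [NormedSpace ℝ F]
  {E : X → Type*} [∀ x, NormedAddCommGroup (E x)] [∀ x, InnerProductSpace ℝ (E x)]
  [TopologicalSpace (TotalSpace F E)] [FiberBundle F E] [VectorBundle ℝ F E]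

variable [IsContinuousRiemannianBundle F E]

theorem integrable_of_continuous {f : X → ℝ} (hf : Continuous f) : Integrable f ν := by
  simpa using hf.continuousOn.integrableOn_compact' isCompact_univ MeasurableSet.univ

variable (F) in
theorem integrable_inner_section {a b : ∀ x, E x}
    (ha : Continuous fun x => TotalSpace.mk' F x (a x))
    (hb : Continuous fun x => TotalSpace.mk' F x (b x)) :
    Integrable (fun x => ⟪a x, b x⟫_ℝ) ν :=
  integrable_of_continuous (ha.inner_bundle hb)

variable (F) in
theorem tendsto_integral_inner {a : ∀ x, E x}
    (ha : Continuous fun x => TotalSpace.mk' F x (a x))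
    {b : ℕ → ∀ x, E x} (hb : ∀ k, Continuous fun x => TotalSpace.mk' F x (b k x))
    {c : ∀ x, E x} (hc : Continuous fun x => TotalSpace.mk' F x (c x))
    {δ : ℕ → ℝ} (hδ : Filter.Tendsto δ Filter.atTop (𝓝 0))
    (hbc : ∀ k x, ‖b k x - c x‖ ≤ δ k) :
    Filter.Tendsto (fun k => ∫ x, ⟪a x, b k x⟫_ℝ ∂ν) Filter.atTop (𝓝 (∫ x, ⟪a x, c x⟫_ℝ ∂ν)) := by
  obtain ⟨M, -, hM⟩ := exists_norm_section_le ha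
  have h := (tendsto_integral_inner_zero (ν := ν) hM hδ hbc).add_const (∫ x, ⟪a x, c x⟫_ℝ ∂ν)
  rw [zero_add] at h
  refine h.congr fun k => ?_
  simp_rw [inner_sub_right]
  rw [integral_sub (integrable_inner_section F ha (hb k)) (integrable_inner_section F ha hc),
    sub_add_cancel]

variable (F) in
theorem eq_zero_of_integral_inner_self [ν.IsOpenPosMeasure] {a : ∀ x, E x}
    (ha : Continuous fun x => TotalSpace.mk' F x (a x))
    (h0 : ∫ x, ⟪a x, a x⟫_ℝ ∂ν = 0) (x : X) : a x = 0 := by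
  have hae := (integral_eq_zero_iff_of_nonneg (μ := ν) (fun x => real_inner_self_nonneg)
    (integrable_inner_section F ha ha)).1 h0
  have := (ha.inner_bundle ha).ae_eq_iff_eq ν continuous_const |>.1 hae
  exact inner_self_eq_zero.1 (congrFun this x)

variable [ChartedSpace (EuclideanSpace ℝ (Fin n)) X] [IsManifold (𝓡 n) ∞ X] [T2Space X]
  [ContMDiffVectorBundle ∞ F E (𝓡 n)] [FiniteDimensional ℝ F]

omit [MeasurableSpace X] [BorelSpace X] in
variable (n F) in
/-- Smooth sections are uniformly dense in the continuous ones. -/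
theorem exists_smoothSection_norm_sub_le {a : ∀ x, E x}
    (ha : Continuous fun x => TotalSpace.mk' F x (a x)) {ε : ℝ} (hε : 0 < ε) :
    ∃ φ : SmoothSection (n := n) F E, ∀ x, ‖φ x - a x‖ ≤ ε := by
  obtain ⟨s, hs⟩ := exists_contMDiffSection_forall_mem_convex_of_local (n := ⊤) (𝓡 n)
    (F_fiber := F) E (fun x => Metric.closedBall (a x) ε) (fun x => convex_closedBall _ _)
    fun x₀ => by
      let τ := trivializationAt F E x₀
      let b := Module.finBasis ℝ F
      have hx₀ : x₀ ∈ τ.baseSet := FiberBundle.mem_baseSet_trivializationAt' x₀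
      -- near `x₀`, the section with constant coefficients that takes the value `a x₀`
      let s : ∀ x, E x := fun x => ∑ j, b.repr (τ ⟨x₀, a x₀⟩).2 j • τ.localFrame b j x
      have hs : ContMDiffOn (𝓡 n) ((𝓡 n).prod 𝓘(ℝ, F)) ∞
          (fun x => TotalSpace.mk' F x (s x)) τ.baseSet :=
        ContMDiffOn.sum_section fun j _ => ContMDiffOn.const_smul_section
          (τ.contMDiffOn_localFrame_baseSet (I := 𝓡 n) ∞ b j)
      have hsx : s x₀ = a x₀ := by
        conv_rhs => rw [← (τ.basisAt b hx₀).sum_repr (a x₀)]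
        refine Finset.sum_congr rfl fun j _ => ?_
        rw [τ.localFrame_apply_of_mem_baseSet b hx₀]
        simp [Trivialization.basisAt]
      have hc : ContinuousOn (fun x => ‖s x - a x‖) τ.baseSet := by
        have h2 : ContMDiffOn (𝓡 n) ((𝓡 n).prod 𝓘(ℝ, F)) 0
          (fun x => TotalSpace.mk' F x (a x)) τ.baseSet :=
          (contMDiff_zero_iff.2 ha).contMDiffOn
        exact continuousOn_norm_bundle ((hs.of_le (by simp)).sub_section h2).continuousOn
      have hev : ∀ᶠ x in 𝓝 x₀, ‖s x - a x‖ < ε :=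
        (hc.continuousAt (τ.open_baseSet.mem_nhds hx₀)).eventually_lt_const (by simpa [hsx])
      refine ⟨_, Filter.inter_mem (τ.open_baseSet.mem_nhds hx₀) hev, s,
        hs.mono inter_subset_left, fun y hy => ?_⟩
      rw [mem_closedBall_iff_norm]
      exact le_of_lt hy.2
  exact ⟨s, fun x => mem_closedBall_iff_norm.1 (hs x)⟩

variable (n F) in
/-- A continuous section is determined by the distribution that it defines. -/
theorem eq_of_integral_inner_eq [ν.IsOpenPosMeasure] {a b : ∀ x, E x}
    (ha : Continuous fun x => TotalSpace.mk' F x (a x))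
    (hb : Continuous fun x => TotalSpace.mk' F x (b x))
    (h : ∀ φ : SmoothSection (n := n) F E,
      ∫ x, ⟪a x, φ x⟫_ℝ ∂ν = ∫ x, ⟪b x, φ x⟫_ℝ ∂ν) (x : X) : a x = b x := by
  have hd := continuous_sub_section n ha hb
  have hδ := tendsto_one_div_add_atTop_nhds_zero_nat (𝕜 := ℝ)
  choose φ hφ using fun k : ℕ => exists_smoothSection_norm_sub_le n F hd
    (Nat.one_div_pos_of_nat (α := ℝ) (n := k))
  have ht := tendsto_integral_inner (ν := ν) F hd (fun k => (φ k).contMDiff.continuous) hd hδ hφ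
  have h0 : ∀ k, ∫ x, ⟪a x - b x, φ k x⟫_ℝ ∂ν = 0 := fun k => by
    simp_rw [inner_sub_left]
    rw [integral_sub (integrable_inner_section F ha (φ k).contMDiff.continuous)
      (integrable_inner_section F hb (φ k).contMDiff.continuous), h, sub_self]
  simp only [h0] at ht
  exact sub_eq_zero.1 (eq_zero_of_integral_inner_self F hd
    (tendsto_nhds_unique tendsto_const_nhds ht).symm x)

end Pairing

section Adjoint

variable {n : ℕ} {X : Type*} [TopologicalSpace X] [ChartedSpace (EuclideanSpace ℝ (Fin n)) X]
  [CompactSpace X] [MeasurableSpace X] [BorelSpace X] {ν : Measure X} [IsFiniteMeasure ν]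
  {F₁ F₂ : Type*} [NormedAddCommGroup F₁] [NormedSpace ℝ F₁]
  [NormedAddCommGroup F₂] [NormedSpace ℝ F₂]
  {E₁ E₂ : X → Type*}
  [∀ x, NormedAddCommGroup (E₁ x)] [∀ x, InnerProductSpace ℝ (E₁ x)]
  [∀ x, NormedAddCommGroup (E₂ x)] [∀ x, InnerProductSpace ℝ (E₂ x)]
  [TopologicalSpace (TotalSpace F₁ E₁)] [FiberBundle F₁ E₁] [VectorBundle ℝ F₁ E₁]
  [TopologicalSpace (TotalSpace F₂ E₂)] [FiberBundle F₂ E₂] [VectorBundle ℝ F₂ E₂]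
  [IsContinuousRiemannianBundle F₁ E₁] [IsContinuousRiemannianBundle F₂ E₂]
  {A : SmoothSection (n := n) F₁ E₁ →ₗ[ℝ] SmoothSection (n := n) F₂ E₂}
  {B : SmoothSection (n := n) F₂ E₂ →ₗ[ℝ] SmoothSection (n := n) F₁ E₁}

omit [CompactSpace X] [BorelSpace X] [IsFiniteMeasure ν] [IsContinuousRiemannianBundle F₁ E₁]
  [IsContinuousRiemannianBundle F₂ E₂] in
theorem IsFormalAdjoint.symm (h : IsFormalAdjoint ν A B) : IsFormalAdjoint ν B A := by
  intro v u
  have h1 := (h u v).symm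
  simpa only [real_inner_comm] using h1

/-- The formal adjoint of `[A, f]` is `-[B, f]`. The operators are arbitrary maps and the
adjointness is up to a constant `c`, so that the lemma can be applied to commutators again. -/
theorem integral_inner_comm
    {A' : SmoothSection (n := n) F₁ E₁ → SmoothSection (n := n) F₂ E₂}
    {B' : SmoothSection (n := n) F₂ E₂ → SmoothSection (n := n) F₁ E₁} {c : ℝ}
    (h : ∀ u v, ∫ x, ⟪A' u x, v x⟫_ℝ ∂ν = c * ∫ x, ⟪u x, B' v x⟫_ℝ ∂ν)
    (f : C^∞⟮𝓡 n, X; ℝ⟯) (u : SmoothSection (n := n) F₁ E₁) (v : SmoothSection (n := n) F₂ E₂) :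
    ∫ x, ⟪comm A' f u x, v x⟫_ℝ ∂ν = -c * ∫ x, ⟪u x, comm B' f v x⟫_ℝ ∂ν := by
  have h1 := h (mulSection f u) v
  have h2 := h u (mulSection f v)
  simp only [mulSection_apply, real_inner_smul_left, real_inner_smul_right] at h1 h2
  simp only [comm_apply, inner_sub_left, inner_sub_right, real_inner_smul_left,
    real_inner_smul_right]
  have i1 : Integrable (fun x => ⟪A' (mulSection f u) x, v x⟫_ℝ) ν :=
    integrable_inner_section F₂ (A' _).contMDiff.continuous v.contMDiff.continuous
  have i2 : Integrable (fun x => f x * ⟪A' u x, v x⟫_ℝ) ν :=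
    integrable_of_continuous (f.contMDiff.continuous.mul
      (Continuous.inner_bundle (F := F₂) (A' _).contMDiff.continuous v.contMDiff.continuous))
  have i3 : Integrable (fun x => ⟪u x, B' (mulSection f v) x⟫_ℝ) ν :=
    integrable_inner_section F₁ u.contMDiff.continuous (B' _).contMDiff.continuous
  have i4 : Integrable (fun x => f x * ⟪u x, B' v x⟫_ℝ) ν :=
    integrable_of_continuous (f.contMDiff.continuous.mul
      (Continuous.inner_bundle (F := F₁) u.contMDiff.continuous (B' _).contMDiff.continuous))
  rw [integral_sub i1 i2, integral_sub i3 i4, h1, h2]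
  ring

/-- The formal adjoint of a first order operator is of first order. -/
theorem IsFormalAdjoint.isFirstOrder [ν.IsOpenPosMeasure] (h : IsFormalAdjoint ν A B)
    (hA : IsFirstOrder A) : IsFirstOrder B := by
  intro f g v
  have h1 := integral_inner_comm (A' := A) (B' := B) (c := 1) (fun u v => by
    rw [one_mul]; exact h u v) f
  have h2 := integral_inner_comm h1 g (comm (comm B f) g v) v
  rw [hA f g] at h2
  have h3 : ∫ x, ⟪comm (comm B f) g v x, comm (comm B f) g v x⟫_ℝ ∂ν = 0 := by
    simpa using h2.symm
  ext x
  exact eq_zero_of_integral_inner_self F₁ (comm (comm B f) g v).contMDiff.continuous h3 x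

end Adjoint

/-! ### Distributional derivatives and the energy inequality -/

section Limits

variable {n : ℕ} {X : Type*} [TopologicalSpace X] [ChartedSpace (EuclideanSpace ℝ (Fin n)) X]
  {F F₁ F₂ : Type*} [NormedAddCommGroup F] [NormedSpace ℝ F]
  [NormedAddCommGroup F₁] [NormedSpace ℝ F₁] [NormedAddCommGroup F₂] [NormedSpace ℝ F₂]
  {E E₁ E₂ : X → Type*}
  [∀ x, NormedAddCommGroup (E x)] [∀ x, InnerProductSpace ℝ (E x)]
  [∀ x, NormedAddCommGroup (E₁ x)] [∀ x, InnerProductSpace ℝ (E₁ x)]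
  [∀ x, NormedAddCommGroup (E₂ x)] [∀ x, InnerProductSpace ℝ (E₂ x)]
  [TopologicalSpace (TotalSpace F E)] [FiberBundle F E] [VectorBundle ℝ F E]
  [TopologicalSpace (TotalSpace F₁ E₁)] [FiberBundle F₁ E₁] [VectorBundle ℝ F₁ E₁]
  [TopologicalSpace (TotalSpace F₂ E₂)] [FiberBundle F₂ E₂] [VectorBundle ℝ F₂ E₂]
  {P : SmoothSection (n := n) F E →ₗ[ℝ] SmoothSection (n := n) F₁ E₁}
  {Q : SmoothSection (n := n) F E →ₗ[ℝ] SmoothSection (n := n) F₂ E₂}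
  {u : ∀ x, E x} {g : ∀ x, E₁ x} {k : ∀ x, E₂ x}

theorem IsLimOfSmooth.exists_seq (h : IsLimOfSmooth P Q u g k) :
    ∃ (φ : ℕ → SmoothSection (n := n) F E) (δ : ℕ → ℝ),
      Filter.Tendsto δ Filter.atTop (𝓝 0) ∧ (∀ j x, ‖φ j x - u x‖ ≤ δ j) ∧
      (∀ j x, ‖P (φ j) x - g x‖ ≤ δ j) ∧ ∀ j x, ‖Q (φ j) x - k x‖ ≤ δ j := by
  choose φ hφ using fun j : ℕ => h _ (Nat.one_div_pos_of_nat (α := ℝ) (n := j))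
  exact ⟨φ, _, tendsto_one_div_add_atTop_nhds_zero_nat (𝕜 := ℝ), fun j x => (hφ j x).1,
    fun j x => (hφ j x).2.1, fun j x => (hφ j x).2.2⟩

variable [CompactSpace X] [MeasurableSpace X] [BorelSpace X] {ν : Measure X} [IsFiniteMeasure ν]
  [IsContinuousRiemannianBundle F E] [IsContinuousRiemannianBundle F₁ E₁]
  {B : SmoothSection (n := n) F₁ E₁ →ₗ[ℝ] SmoothSection (n := n) F E}

/-- Uniform limits commute with differential operators in the sense of distributions. -/
theorem DistribEq.of_tendsto (hB : IsFormalAdjoint ν P B)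
    (hu : Continuous fun x => TotalSpace.mk' F x (u x))
    (hg : Continuous fun x => TotalSpace.mk' F₁ x (g x))
    {φ : ℕ → SmoothSection (n := n) F E} {δ : ℕ → ℝ}
    (hδ : Filter.Tendsto δ Filter.atTop (𝓝 0)) (h0 : ∀ j x, ‖φ j x - u x‖ ≤ δ j)
    (h1 : ∀ j x, ‖P (φ j) x - g x‖ ≤ δ j) : DistribEq ν B u g := by
  intro ψ
  have t0 := tendsto_integral_inner (ν := ν) F (B ψ).contMDiff.continuous
    (fun j => (φ j).contMDiff.continuous) hu hδ h0
  have t1 := tendsto_integral_inner (ν := ν) F₁ ψ.contMDiff.continuous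
    (fun j => (P (φ j)).contMDiff.continuous) hg hδ h1
  have he : ∀ j, ∫ x, ⟪ψ x, P (φ j) x⟫_ℝ ∂ν = ∫ x, ⟪B ψ x, φ j x⟫_ℝ ∂ν := fun j =>
    (hB.symm ψ (φ j)).symm
  simp only [he] at t1
  have := tendsto_nhds_unique t0 t1
  simpa only [real_inner_comm] using this

variable [T2Space X] [IsManifold (𝓡 n) ∞ X] [ν.IsOpenPosMeasure]
  [ContMDiffVectorBundle ∞ F₁ E₁ (𝓡 n)] [FiniteDimensional ℝ F₁]

omit [IsContinuousRiemannianBundle F E] in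
/-- `distribApply` has the value `A u` whenever this is a continuous section. -/
theorem distribApply_eq (hg : Continuous fun x => TotalSpace.mk' F₁ x (g x))
    (h : DistribEq ν B u g) : distribApply ν B u = g := by
  have hex : ∃ g : ∀ x, E₁ x, Continuous (fun x => TotalSpace.mk' F₁ x (g x)) ∧
    DistribEq ν B u g := ⟨g, hg, h⟩
  rw [distribApply, dif_pos hex]
  funext x
  exact eq_of_integral_inner_eq (ν := ν) n F₁ hex.choose_spec.1 hg
    (fun φ => (hex.choose_spec.2 φ).symm.trans (h φ)) x

end Limits

section TimeDependentSections

theorem ContSection.slice {X F : Type*} [TopologicalSpace X] {E : X → Type*}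
    [TopologicalSpace (TotalSpace F E)] {T : ℝ} {a : ℝ → ∀ x, E x} (h : ContSection F T a)
    {t : ℝ} (ht : t ∈ Icc 0 T) : Continuous fun x => TotalSpace.mk' F x (a t x) :=
  h.comp_continuous (continuous_const.prodMk continuous_id) fun x => ⟨ht, mem_univ x⟩

variable {X : Type*} [TopologicalSpace X]
  {F : Type*} [NormedAddCommGroup F] [NormedSpace ℝ F]
  {E : X → Type*} [∀ x, NormedAddCommGroup (E x)] [∀ x, InnerProductSpace ℝ (E x)]
  [TopologicalSpace (TotalSpace F E)] [FiberBundle F E] [VectorBundle ℝ F E]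
  {T : ℝ} {a b : ℝ → ∀ x, E x}

theorem ContSection.exists_norm_le [CompactSpace X] [IsContinuousRiemannianBundle F E]
    (h : ContSection F T a) : ∃ C : ℝ, 0 ≤ C ∧ ∀ t ∈ Icc 0 T, ∀ x, ‖a t x‖ ≤ C := by
  obtain ⟨C, hC⟩ := (isCompact_Icc.prod isCompact_univ).exists_bound_of_continuousOn
    (continuousOn_norm_bundle (b := fun q : ℝ × X => q.2) (s := fun q => a q.1 q.2) h)
  exact ⟨max C 0, le_max_right _ _, fun t ht x =>
    le_trans (by simpa using hC (t, x) ⟨ht, mem_univ x⟩) (le_max_left _ _)⟩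

theorem ContSection.continuousOn_integral_inner [CompactSpace X] [MeasurableSpace X] [BorelSpace X]
    {ν : Measure X} [IsFiniteMeasure ν] [IsContinuousRiemannianBundle F E]
    (ha : ContSection F T a) (hb : ContSection F T b) :
    ContinuousOn (fun t => ∫ x, ⟪a t x, b t x⟫_ℝ ∂ν) (Icc 0 T) := by
  have hc : ContinuousOn (fun q : ℝ × X => ⟪a q.1 q.2, b q.1 q.2⟫_ℝ) (Icc 0 T ×ˢ univ) :=
    ContinuousOn.inner_bundle (b := fun q : ℝ × X => q.2) ha hb
  obtain ⟨C, hC⟩ := (isCompact_Icc.prod isCompact_univ).exists_bound_of_continuousOn hc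
  refine continuousOn_of_dominated (bound := fun _ => C) (fun t ht => ?_) (fun t ht => ?_)
    (integrable_const _) ?_
  · exact (hc.comp_continuous (f := fun x : X => (t, x)) (by fun_prop)
      fun x => ⟨ht, mem_univ x⟩).aestronglyMeasurable
  · exact Filter.Eventually.of_forall fun x => hC (t, x) ⟨ht, mem_univ x⟩
  · exact Filter.Eventually.of_forall fun x => hc.comp (f := fun t : ℝ => (t, x)) (by fun_prop)
      fun t ht => ⟨ht, mem_univ x⟩

/-- The derivative of the kinetic energy. -/
theorem ContSection.hasDerivAt_integral_inner_self [CompactSpace X] [MeasurableSpace X]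
    [BorelSpace X] {ν : Measure X} [IsFiniteMeasure ν] [IsContinuousRiemannianBundle F E]
    (ha : ContSection F T a) (hb : ContSection F T b)
    (hd : ∀ t ∈ Ioo 0 T, ∀ x, HasDerivAt (fun s => a s x) (b t x) t) {t : ℝ} (ht : t ∈ Ioo 0 T) :
    HasDerivAt (fun t => ∫ x, ⟪a t x, a t x⟫_ℝ ∂ν) (2 * ∫ x, ⟪b t x, a t x⟫_ℝ ∂ν) t := by
  obtain ⟨C, -, hC⟩ := ha.exists_norm_le
  obtain ⟨D, hD0, hD⟩ := hb.exists_norm_le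
  have hI : ∀ {c e : ℝ → ∀ x, E x}, ContSection F T c → ContSection F T e → ∀ s ∈ Ioo 0 T,
      Continuous fun x => ⟪c s x, e s x⟫_ℝ := by
    intro c e hc he s hs
    exact (ContinuousOn.inner_bundle (b := fun q : ℝ × X => q.2) hc he).comp_continuous
      (f := fun x : X => (s, x)) (by fun_prop) fun x => ⟨Ioo_subset_Icc_self hs, mem_univ x⟩
  have key := (hasDerivAt_integral_of_dominated_loc_of_deriv_le (μ := ν) (𝕜 := ℝ) (x₀ := t)
    (F := fun s x => ⟪a s x, a s x⟫_ℝ) (F' := fun s x => 2 * ⟪b s x, a s x⟫_ℝ)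
    (bound := fun _ => 2 * (D * C)) (s := Ioo 0 T) (isOpen_Ioo.mem_nhds ht)
    (Filter.eventually_of_mem (isOpen_Ioo.mem_nhds ht) fun s hs =>
      (hI ha ha s hs).aestronglyMeasurable)
    (integrable_of_continuous (hI ha ha t ht))
    ((hI hb ha t ht).aestronglyMeasurable.const_mul 2)
    (Filter.Eventually.of_forall fun x s hs => ?_) (integrable_const _)
    (Filter.Eventually.of_forall fun x s hs => ?_)).2
  · rwa [integral_const_mul] at key
  · have hs' := Ioo_subset_Icc_self hs
    rw [norm_mul, Real.norm_ofNat]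
    gcongr
    exact (norm_inner_le_norm _ _).trans
      (mul_le_mul (hD s hs' x) (hC s hs' x) (norm_nonneg _) hD0)
  · have h := (hd s hs x).inner ℝ (hd s hs x)
    refine h.congr_deriv ?_
    rw [real_inner_comm (b s x) (a s x)]
    ring

end TimeDependentSections

/-- Gronwall's inequality with zero initial value, for a function that need not be differentiable
at the endpoints. -/
theorem nonpos_of_deriv_le_mul {T K : ℝ} {y y' : ℝ → ℝ} (hc : ContinuousOn y (Icc 0 T))
    (hd : ∀ t ∈ Ioo 0 T, HasDerivAt y (y' t) t) (hle : ∀ t ∈ Ioo 0 T, y' t ≤ K * y t)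
    (h0 : y 0 = 0) {t : ℝ} (ht : t ∈ Icc 0 T) : y t ≤ 0 := by
  have hder : ∀ s ∈ Ioo 0 T, HasDerivAt (fun s => Real.exp (-K * s) * y s)
      (Real.exp (-K * s) * (y' s - K * y s)) s := by
    intro s hs
    have h1 : HasDerivAt (fun s => Real.exp (-K * s)) (Real.exp (-K * s) * (-K)) s := by
      simpa using ((hasDerivAt_id s).const_mul (-K)).exp
    refine (h1.mul (hd s hs)).congr_deriv ?_
    ring
  have hanti : AntitoneOn (fun s => Real.exp (-K * s) * y s) (Icc 0 T) := by
    refine antitoneOn_of_deriv_nonpos (convex_Icc 0 T) (by fun_prop) ?_ ?_ <;> rw [interior_Icc]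
    · exact fun s hs => (hder s hs).differentiableAt.differentiableWithinAt
    · intro s hs
      rw [(hder s hs).deriv]
      exact mul_nonpos_of_nonneg_of_nonpos (Real.exp_pos _).le (by linarith [hle s hs])
  have h := hanti (left_mem_Icc.2 (ht.1.trans ht.2)) ht ht.1
  simp only [h0, mul_zero] at h
  exact nonpos_of_mul_nonpos_right h (Real.exp_pos _)

section Energy

variable {n : ℕ} {X : Type*} [TopologicalSpace X] [T2Space X] [CompactSpace X]
  [ChartedSpace (EuclideanSpace ℝ (Fin n)) X] [IsManifold (𝓡 n) ∞ X]
  [MeasurableSpace X] [BorelSpace X] {ν : Measure X} [IsFiniteMeasure ν] [ν.IsOpenPosMeasure]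
  {F : ℤ → Type*} [∀ k, NormedAddCommGroup (F k)] [∀ k, NormedSpace ℝ (F k)]
  [∀ k, FiniteDimensional ℝ (F k)]
  {E : ℤ → X → Type*} [∀ k x, NormedAddCommGroup (E k x)] [∀ k x, InnerProductSpace ℝ (E k x)]
  [∀ k, TopologicalSpace (TotalSpace (F k) (E k))] [∀ k, FiberBundle (F k) (E k)]
  [∀ k, VectorBundle ℝ (F k) (E k)] [∀ k, ContMDiffVectorBundle ∞ (F k) (E k) (𝓡 n)]
  [∀ k, IsContinuousRiemannianBundle (F k) (E k)]
  {N : ℕ} (C : EllipticComplex (n := n) F E N ν) {i : ℤ}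

/-- A `C^1` section `u` with `(A^{i-1})^* u = 0` is a limit of smooth sections `φ` such that
`A^i φ → A^i u` and `(A^{i-1})^* φ → 0` uniformly. -/
theorem EllipticComplex.exists_seq_of_divergence_free {u : ∀ x, E i x}
    (huc : Continuous fun x => TotalSpace.mk' (F i) x (u x))
    (hu : ∀ x₀, ContDiffOn ℝ 1 (localRep (n := n) (F i) x₀ u) (localDom (F i) (E i) x₀))
    (hdiv : DistribEq ν (C.d (i - 1) i) u (fun _ => 0)) :
    Continuous (fun x => TotalSpace.mk' (F (i + 1)) x (C.apply i u x)) ∧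
    DistribEq ν (C.dstar i (i + 1)) u (C.apply i u) ∧
    ∃ (φ : ℕ → SmoothSection (n := n) (F i) (E i)) (δ : ℕ → ℝ),
      Filter.Tendsto δ Filter.atTop (𝓝 0) ∧ (∀ j x, ‖φ j x - u x‖ ≤ δ j) ∧
      (∀ j x, ‖C.d i (i + 1) (φ j) x - C.apply i u x‖ ≤ δ j) ∧
      ∀ j x, ‖C.dstar (i - 1) i (φ j) x‖ ≤ δ j := by
  have hadj := C.isFormalAdjoint (i - 1) i (by ring)
  obtain ⟨g, k, hg, hk, hlim⟩ := exists_isLimOfSmooth (C.firstOrder i (i + 1) rfl)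
    (hadj.isFirstOrder (C.firstOrder (i - 1) i (by ring))) hu
  obtain ⟨φ, δ, hδ, h0, h1, h2⟩ := hlim.exists_seq
  have hgd := DistribEq.of_tendsto (C.isFormalAdjoint i (i + 1) rfl) huc hg hδ h0 h1
  have hkd := DistribEq.of_tendsto hadj.symm huc hk hδ h0 h2
  have hg' : C.apply i u = g := distribApply_eq hg hgd
  have hk0 : ∀ x, k x = 0 := eq_of_integral_inner_eq (ν := ν) n (F (i - 1)) hk
    (continuous_zero_section (F (i - 1)) (E (i - 1)) n)
    fun ψ => (hkd ψ).symm.trans (hdiv ψ)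
  rw [hg']
  exact ⟨hg, hgd, φ, δ, hδ, h0, h1, fun j x => by simpa [hk0 x] using h2 j x⟩

/-- The energy inequality: the momentum equation, given for smooth test sections, is tested with
the `C^1` section `u` itself. The terms that are paired with `(A^{i-1})^* φ` disappear. -/
theorem EllipticComplex.energy_le {u v : ∀ x, E i x}
    (huc : Continuous fun x => TotalSpace.mk' (F i) x (u x))
    (hvc : Continuous fun x => TotalSpace.mk' (F i) x (v x))
    (hu : ∀ x₀, ContDiffOn ℝ 1 (localRep (n := n) (F i) x₀ u) (localDom (F i) (E i) x₀))
    (hdiv : DistribEq ν (C.d (i - 1) i) u (fun _ => 0))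
    {μ : ℝ} {m : ∀ x, E i x} {w : X → ℝ} (hw : Continuous w) (hm : ∀ x, ‖m x‖ ≤ w x)
    {q p : ∀ x, E (i - 1) x} {Mq Mp : ℝ} (hq : ∀ x, ‖q x‖ ≤ Mq) (hp : ∀ x, ‖p x‖ ≤ Mp)
    (heq : ∀ φ : SmoothSection (n := n) (F i) (E i),
      (∫ x, ⟪v x, φ x⟫_ℝ ∂ν) + μ * (∫ x, ⟪u x, C.laplacian i φ x⟫_ℝ ∂ν)
      + (∫ x, ⟪m x, φ x⟫_ℝ ∂ν) + (∫ x, ⟪q x, C.dstar (i - 1) i φ x⟫_ℝ ∂ν)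
      + (∫ x, ⟪p x, C.dstar (i - 1) i φ x⟫_ℝ ∂ν) = 0) :
    (∫ x, ⟪v x, u x⟫_ℝ ∂ν) + μ * ∫ x, ⟪C.apply i u x, C.apply i u x⟫_ℝ ∂ν ≤
      ∫ x, w x * ‖u x‖ ∂ν := by
  obtain ⟨hg, hgd, φ, δ, hδ, h0, h1, h2⟩ := C.exists_seq_of_divergence_free huc hu hdiv
  have tv := tendsto_integral_inner (ν := ν) (F i) hvc
    (fun j => (φ j).contMDiff.continuous) huc hδ h0
  have tg := tendsto_integral_inner (ν := ν) (F (i + 1)) hg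
    (fun j => (C.d i (i + 1) (φ j)).contMDiff.continuous) hg hδ h1
  have tq := tendsto_integral_inner_zero (ν := ν) hq hδ h2
  have tp := tendsto_integral_inner_zero (ν := ν) hp hδ h2
  have hlap : ∀ j, ∫ x, ⟪u x, C.laplacian i (φ j) x⟫_ℝ ∂ν =
      ∫ x, ⟪C.apply i u x, C.d i (i + 1) (φ j) x⟫_ℝ ∂ν := by
    intro j
    have e1 := hgd (C.d i (i + 1) (φ j))
    have e2 := hdiv (C.dstar (i - 1) i (φ j))
    simp only [inner_zero_left, integral_zero] at e2
    have e3 : ∀ x, ⟪u x, C.laplacian i (φ j) x⟫_ℝ =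
        ⟪u x, C.dstar i (i + 1) (C.d i (i + 1) (φ j)) x⟫_ℝ +
        ⟪u x, C.d (i - 1) i (C.dstar (i - 1) i (φ j)) x⟫_ℝ := fun x => inner_add_right _ _ _
    simp_rw [e3]
    rw [integral_add
      (integrable_inner_section (F i) huc
        (C.dstar i (i + 1) (C.d i (i + 1) (φ j))).contMDiff.continuous)
      (integrable_inner_section (F i) huc
        (C.d (i - 1) i (C.dstar (i - 1) i (φ j))).contMDiff.continuous), e1, e2, add_zero]
  have hnu := continuous_norm_section huc
  have hbd : ∀ j, -∫ x, ⟪m x, φ j x⟫_ℝ ∂ν ≤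
      (∫ x, w x * ‖u x‖ ∂ν) + (∫ x, w x ∂ν) * δ j := by
    intro j
    refine (neg_le_abs _).trans ?_
    have i1 : Integrable (fun x => w x * ‖u x‖) ν := integrable_of_continuous (hw.mul hnu)
    have i2 : Integrable (fun x => w x * δ j) ν :=
      integrable_of_continuous (hw.mul continuous_const)
    rw [← integral_mul_const, ← integral_add i1 i2, ← Real.norm_eq_abs]
    refine norm_integral_le_of_norm_le (i1.add i2)
      (Filter.Eventually.of_forall fun x => ?_)
    refine (norm_inner_le_norm _ _).trans ?_
    rw [← mul_add]
    refine mul_le_mul (hm x) ?_ (norm_nonneg _) ((norm_nonneg _).trans (hm x))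
    calc ‖φ j x‖ = ‖u x + (φ j x - u x)‖ := by rw [add_sub_cancel]
      _ ≤ ‖u x‖ + δ j := (norm_add_le _ _).trans (by linarith [h0 j x])
  have hl := ((tv.add (tg.const_mul μ)).add tq).add tp
  have hr := (hδ.const_mul (∫ x, w x ∂ν)).const_add (∫ x, w x * ‖u x‖ ∂ν)
  rw [add_zero, add_zero] at hl
  rw [mul_zero, add_zero] at hr
  refine le_of_tendsto_of_tendsto' hl hr fun j => ?_
  have h := heq (φ j)
  rw [hlap j] at h
  linarith [hbd j]

end Energy

end NSComplex

/-! ### Uniqueness -/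

theorem theoremt {n : ℕ} (hn : 2 ≤ n)
    {X : Type*} [TopologicalSpace X] [T2Space X] [CompactSpace X]
    [ChartedSpace (EuclideanSpace ℝ (Fin n)) X] [IsManifold (𝓡 n) ∞ X]
    [MeasurableSpace X] [BorelSpace X]
    (ν : Measure X) (hν : NSComplex.IsSmoothVolume (n := n) ν)
    (F : ℤ → Type*) [∀ k, NormedAddCommGroup (F k)] [∀ k, NormedSpace ℝ (F k)]
    [∀ k, FiniteDimensional ℝ (F k)]
    (E : ℤ → X → Type*) [∀ k x, NormedAddCommGroup (E k x)]
    [∀ k x, InnerProductSpace ℝ (E k x)]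
    [∀ k, TopologicalSpace (TotalSpace (F k) (E k))] [∀ k, FiberBundle (F k) (E k)]
    [∀ k, VectorBundle ℝ (F k) (E k)] [∀ k, ContMDiffVectorBundle ∞ (F k) (E k) (𝓡 n)]
    [∀ k, IsContMDiffRiemannianBundle (𝓡 n) ∞ (F k) (E k)]
    (N : ℕ) (C : NSComplex.EllipticComplex (n := n) F E N ν)
    (i : ℤ) (hi₀ : 0 ≤ i) (hiN : i ≤ N)
    (M : NSComplex.BilinearMaps F E i ν)
    (T μ : ℝ) (hT : 0 < T) (hμ : 0 < μ)
    (u₀ : ℝ → ∀ x, E i x) (hu₀ : NSComplex.InDomain ν T (C.dstar i (i + 1)) u₀)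
    (u : ℝ → ∀ x, E i x) (p : ℝ → ∀ x, E (i - 1) x)
    (hu : NSComplex.IsC210 (n := n) (F i) T u)
    (hp : NSComplex.InDomain ν T (C.dstar (i - 1) i) p)
    (hsol : NSComplex.IsLinearisedSolution C i M T μ u₀ (fun _ _ => 0) (fun _ => 0) u p) :
    (∀ t ∈ Icc 0 T, ∀ x, u t x = 0) ∧
    (∀ t ∈ Icc 0 T, NSComplex.DistribEq ν (C.dstar (i - 1) i) (p t) (fun _ => 0)) := by
  have : IsFiniteMeasure ν := hν.isFiniteMeasure
  have : ν.IsOpenPosMeasure := hν.isOpenPosMeasure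
  have : ∀ k, IsContinuousRiemannianBundle (F k) (E k) := fun k => by
    obtain ⟨g, hg, hg'⟩ := IsContMDiffRiemannianBundle.exists_contMDiff (IB := 𝓡 n) (n := ∞)
      (F := F k) (E := E k)
    exact ⟨g, hg.continuous, hg'⟩
  obtain ⟨hu₀c, g₀, hg₀c, hg₀⟩ := hu₀
  obtain ⟨v, hvc, hv⟩ := hu.time
  have hvd : ∀ t ∈ Ioo 0 T, ∀ x, HasDerivAt (fun s => u s x) (v t x) t := fun t ht x =>
    (hv t (Ioo_subset_Icc_self ht) x).hasDerivAt (Icc_mem_nhds ht.1 ht.2)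
  have hAu₀ : ∀ t ∈ Icc 0 T, C.apply i (u₀ t) = g₀ t := fun t ht =>
    NSComplex.distribApply_eq (hg₀c.slice ht) (hg₀ t ht)
  have hmom := hsol.momentum
  simp only [inner_zero_left, integral_zero] at hmom
  have hu0 : ∀ t ∈ Icc 0 T, ∀ x, u t x = 0 := by
    obtain ⟨U₀, hU₀0, hU₀⟩ := hu₀c.exists_norm_le
    obtain ⟨G₀, hG₀0, hG₀⟩ := hg₀c.exists_norm_le
    obtain ⟨U, hU0, hU⟩ := hu.cont.exists_norm_le
    obtain ⟨Mp, -, hMp⟩ := hp.1.exists_norm_le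
    obtain ⟨c₁, hc₁⟩ := M.bound₁
    obtain ⟨c₂, hc₂⟩ := M.bound₂
    have hM₁ : ∀ x a b, ‖M.M₁ x a b‖ ≤ |c₁| * ‖b‖ * ‖a‖ := fun x a b =>
      (hc₁ x a b).trans (by gcongr; exact le_abs_self _)
    have hM₂ : ∀ x a b, ‖M.M₂ x a b‖ ≤ |c₂| * ‖b‖ * ‖a‖ := fun x a b =>
      (hc₂ x a b).trans (by gcongr; exact le_abs_self _)
    set K := |c₁| * G₀ + (|c₁| * U₀) ^ 2 / (4 * μ) with hK
    have henergy : ∀ t ∈ Ioo 0 T, ∫ x, ⟪v t x, u t x⟫_ℝ ∂ν ≤ K * ∫ x, ⟪u t x, u t x⟫_ℝ ∂ν := by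
      intro t ht
      have ht' := Ioo_subset_Icc_self ht
      have huc := hu.cont.slice ht'
      have hu1 : ∀ x₀, ContDiffOn ℝ 1 (NSComplex.localRep (n := n) (F i) x₀ (u t))
          (NSComplex.localDom (F i) (E i) x₀) := fun x₀ =>
        (hu.space_diff x₀ t ht').of_le (by norm_num)
      have hdiv := hsol.divergence_u t ht'
      obtain ⟨hgc, -, -⟩ := C.exists_seq_of_divergence_free huc hu1 hdiv
      set g := C.apply i (u t) with hg
      have hnu := NSComplex.continuous_norm_section huc
      have hng := NSComplex.continuous_norm_section hgc
      have key := C.energy_le (μ := μ) huc (hvc.slice ht') hu1 hdiv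
        (m := fun x => M.M₁ x (C.apply i (u₀ t) x) (u t x) + M.M₁ x (g x) (u₀ t x))
        (w := fun x => |c₁| * G₀ * ‖u t x‖ + |c₁| * U₀ * ‖g x‖) (by fun_prop)
        (fun x => by
          refine (norm_add_le _ _).trans (add_le_add ((hM₁ _ _ _).trans ?_)
            ((hM₁ _ _ _).trans ?_))
          · rw [hAu₀ t ht', mul_right_comm]
            have := hG₀ t ht' x
            gcongr
          · have := hU₀ t ht' x
            gcongr)
        (q := fun x => M.M₂ x (u t x) (u₀ t x) + M.M₂ x (u₀ t x) (u t x))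
        (Mq := |c₂| * U₀ * U + |c₂| * U * U₀)
        (fun x => by
          have h1 := hU₀ t ht' x
          have h2 := hU t ht' x
          refine (norm_add_le _ _).trans (add_le_add ((hM₂ _ _ _).trans ?_)
            ((hM₂ _ _ _).trans ?_)) <;> gcongr)
        (hMp t ht') (fun φ => by
          have h := hmom t ht φ
          simp only [(hvd t ht _).deriv] at h
          exact h)
      rw [← hg] at key
      have hIu := NSComplex.integrable_inner_section (ν := ν) (F i) huc huc
      have hIg := NSComplex.integrable_inner_section (ν := ν) (F (i + 1)) hgc hgc
      have hle : ∫ x, (|c₁| * G₀ * ‖u t x‖ + |c₁| * U₀ * ‖g x‖) * ‖u t x‖ ∂ν ≤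
          K * (∫ x, ⟪u t x, u t x⟫_ℝ ∂ν) + μ * ∫ x, ⟪g x, g x⟫_ℝ ∂ν := by
        rw [← integral_const_mul, ← integral_const_mul,
          ← integral_add (hIu.const_mul K) (hIg.const_mul μ)]
        refine integral_mono (NSComplex.integrable_of_continuous (by fun_prop))
          ((hIu.const_mul K).add (hIg.const_mul μ)) fun x => ?_
        simp only [real_inner_self_eq_norm_sq]
        -- Young's inequality absorbs the term with `A^i u` into the dissipation.
        have hyoung : |c₁| * U₀ * ‖g x‖ * ‖u t x‖ ≤
            (|c₁| * U₀) ^ 2 / (4 * μ) * ‖u t x‖ ^ 2 + μ * ‖g x‖ ^ 2 := by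
          have h := sq_nonneg (|c₁| * U₀ * ‖u t x‖ - 2 * μ * ‖g x‖)
          rw [← sub_nonneg]
          have he : (|c₁| * U₀) ^ 2 / (4 * μ) * ‖u t x‖ ^ 2 + μ * ‖g x‖ ^ 2 -
              |c₁| * U₀ * ‖g x‖ * ‖u t x‖ =
              (|c₁| * U₀ * ‖u t x‖ - 2 * μ * ‖g x‖) ^ 2 / (4 * μ) := by
            field_simp
            ring
          rw [he]
          positivity
        rw [hK]
        linarith
      linarith
    intro t ht x
    have hnonpos := NSComplex.nonpos_of_deriv_le_mul (T := T) (K := 2 * K)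
      (y := fun t => ∫ x, ⟪u t x, u t x⟫_ℝ ∂ν) (hu.cont.continuousOn_integral_inner hu.cont)
      (fun t ht => hu.cont.hasDerivAt_integral_inner_self hvc hvd ht)
      (fun t ht => by linarith [henergy t ht]) (by simp [hsol.initial]) ht
    exact NSComplex.eq_zero_of_integral_inner_self (ν := ν) (F i) (hu.cont.slice ht)
      (le_antisymm hnonpos (integral_nonneg fun x => real_inner_self_nonneg)) x
  refine ⟨hu0, fun t ht φ => ?_⟩
  simp only [inner_zero_left, integral_zero]
  have hzero : ∀ s ∈ Ioo 0 T, ∫ x, ⟪p s x, C.dstar (i - 1) i φ x⟫_ℝ ∂ν = 0 := by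
    intro s hs
    have hs' := Ioo_subset_Icc_self hs
    have hus : u s = fun _ => 0 := funext (hu0 s hs')
    have hAu : C.apply i (u s) = fun _ => 0 := NSComplex.distribApply_eq
      (NSComplex.continuous_zero_section _ _ n) (fun ψ => by simp [hus])
    have hder : ∀ x, deriv (fun r => u r x) s = 0 := by
      intro x
      have : (fun r => u r x) =ᶠ[𝓝 s] fun _ => 0 := by
        filter_upwards [isOpen_Ioo.mem_nhds hs] with r hr
        exact hu0 r (Ioo_subset_Icc_self hr) x
      rw [this.deriv_eq, deriv_const]
    have h := hmom s hs φ
    rw [hus] at hAu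
    simpa [hder, hAu, hus] using h
  -- the equation holds for interior times only; the pairing with `p` is continuous up to the ends
  have hcont : ContinuousOn (fun s => ∫ x, ⟪p s x, C.dstar (i - 1) i φ x⟫_ℝ ∂ν) (Icc 0 T) :=
    hp.1.continuousOn_integral_inner (b := fun _ x => C.dstar (i - 1) i φ x)
      ((C.dstar (i - 1) i φ).contMDiff.continuous.comp continuous_snd).continuousOn
  exact EqOn.of_subset_closure (g := fun _ => (0 : ℝ)) hzero hcont continuousOn_const
    Ioo_subset_Icc_self (closure_Ioo hT.ne).ge ht
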